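/- Let $G$ be an exponential solvable Lie group, that is, a simply connected (finite-dimensional, real) Lie group whose Lie algebra $\mathfrak g$ is solvable and whose exponential map $\exp:\mathfrak g\to G$ is a diffeomorphism. Put $\mathfrak n=[\mathfrak g,\mathfrak g]$. Let $A_1,\dots,A_n$ be a coexponential basis to $\mathfrak n$ in $\mathfrak g$, that is, a basis of a subspace complementary to $\mathfrak n$ such that $$t_1A_1+\dots+t_nA_n+X\mapsto \exp(t_1A_1)\cdots\exp(t_nA_n)\exp(X)\qquad(t\in\mathbb R^n,\ X\in\mathfrak n)$$ is a diffeomorphism from $\mathfrak g$ onto $G$, and let $N_1,\dots,N_m$ be a Malcev basis of $\mathfrak n$, that is, a basis of $\mathfrak n$ such that $\operatorname{span}\{N_j,\dots,N_m\}$ is a Lie subalgebra for every $1\le j\le m$. Define $\Phi:\mathfrak g\to G$ by $$\Phi\Big(\sum_{i=1}^n t_iA_i+\sum_{j=1}^m s_jN_j\Big)=\exp(t_1A_1)\cdots\exp(t_nA_n)\exp(s_1N_1)\cdots\exp(s_mN_m).$$ If $\mu$ is a Haar measure on the additive group $\mathfrak g$ (i.e. a positive multiple of Lebesgue measure), then the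 pushforward $\Phi_*\mu$ is a (left) Haar measure on $G$. -/

import Mathlib

open scoped Manifold ContDiff

noncomputable section

/-- A smooth real Lie group is in particular a Lie group of the regularity that Mathlib uses to
construct the bracket on `GroupLieAlgebra`. -/
instance lieGroup_minSmoothness_three {E : Type*} [NormedAddCommGroup E] [NormedSpace ℝ E]
    {G : Type*} [TopologicalSpace G] [ChartedSpace E G] [Group G] [LieGroup 𝓘(ℝ, E) ∞ G] :
    LieGroup 𝓘(ℝ, E) (minSmoothness ℝ 3) G :=
  LieGroup.of_le (n := ∞) (by
    rw [minSmoothness_of_isRCLikeNormedField]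
    exact ENat.LEInfty.out)

/-- The Lie algebra `𝔤 = T₁G` of a Lie group `G` modelled on the vector space `E`, with the bracket
of left-invariant vector fields. Its underlying vector space is `E`. -/
abbrev LieAlg (E : Type*) [NormedAddCommGroup E] [NormedSpace ℝ E]
    (G : Type*) [TopologicalSpace G] [ChartedSpace E G] [Group G] : Type _ :=
  GroupLieAlgebra 𝓘(ℝ, E) G

open Classical in
/-- The exponential map of a Lie group: `lieExp X = γ 1`, where `γ : ℝ → G` is the integral curve
with `γ 0 = 1` of the left-invariant vector field defined by `X`. (Such a curve always exists and
is unique; the value `1` in the absence of a curve is never used.) -/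
def lieExp {E : Type*} [NormedAddCommGroup E] [NormedSpace ℝ E]
    {G : Type*} [TopologicalSpace G] [ChartedSpace E G] [Group G] (X : LieAlg E G) : G :=
  if h : ∃ γ : ℝ → G,
      γ 0 = 1 ∧ IsMIntegralCurve (I := 𝓘(ℝ, E)) γ (mulInvariantVectorField X)
  then h.choose 1 else 1

/-- `f : 𝔤 → G` is a diffeomorphism of smooth manifolds, where the vector space `𝔤` (which is `E`)
carries its standard smooth structure. -/
def IsDiffeoFromLieAlg {E : Type*} [NormedAddCommGroup E] [NormedSpace ℝ E]
    {G : Type*} [TopologicalSpace G] [ChartedSpace E G] [Group G] (f : LieAlg E G → G) : Prop :=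
  ∃ F : E ≃ₘ⟮𝓘(ℝ, E), 𝓘(ℝ, E)⟯ G, ∀ X : LieAlg E G, f X = F X

/-- An exponential solvable Lie group: simply connected, with solvable Lie algebra, and such that
the exponential map is a global diffeomorphism. -/
structure IsExponentialSolvable (E : Type*) [NormedAddCommGroup E] [NormedSpace ℝ E]
    [CompleteSpace E] (G : Type*) [TopologicalSpace G] [ChartedSpace E G] [Group G]
    [LieGroup 𝓘(ℝ, E) ∞ G] : Prop where
  simplyConnected : SimplyConnectedSpace G
  solvable : LieAlgebra.IsSolvable (LieAlg E G)
  exp_diffeo : IsDiffeoFromLieAlg (lieExp : LieAlg E G → G)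

/-- The ideal `𝔫 = [𝔤, 𝔤]` of the Lie algebra. -/
abbrev derivedIdeal (E : Type*) [NormedAddCommGroup E] [NormedSpace ℝ E] [CompleteSpace E]
    (G : Type*) [TopologicalSpace G] [ChartedSpace E G] [Group G] [LieGroup 𝓘(ℝ, E) ∞ G] :
    LieIdeal ℝ (LieAlg E G) :=
  ⁅(⊤ : LieIdeal ℝ (LieAlg E G)), (⊤ : LieIdeal ℝ (LieAlg E G))⁆

/-- The ordered product `exp (t₁ X₁) ⋯ exp (tₖ Xₖ)` in `G`. -/
def expProd {E : Type*} [NormedAddCommGroup E] [NormedSpace ℝ E]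
    {G : Type*} [TopologicalSpace G] [ChartedSpace E G] [Group G]
    {k : ℕ} (X : Fin k → LieAlg E G) (t : Fin k → ℝ) : G :=
  (List.ofFn fun i => lieExp (t i • X i)).prod

/-- `A₁, …, Aₙ` is a coexponential basis to `𝔥` in `𝔤`: a basis of a subspace complementary to `𝔥`
such that `t₁ A₁ + ⋯ + tₙ Aₙ + X ↦ exp (t₁ A₁) ⋯ exp (tₙ Aₙ) exp X` (`t ∈ ℝⁿ`, `X ∈ 𝔥`) is a
diffeomorphism from `𝔤` onto `G`. -/
structure IsCoexponentialBasis {E : Type*} [NormedAddCommGroup E] [NormedSpace ℝ E]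
    {G : Type*} [TopologicalSpace G] [ChartedSpace E G] [Group G]
    (𝔥 : Submodule ℝ (LieAlg E G)) {n : ℕ} (A : Fin n → LieAlg E G) : Prop where
  linearIndependent : LinearIndependent ℝ A
  isCompl : IsCompl (Submodule.span ℝ (Set.range A)) 𝔥
  diffeo : ∃ Ψ : LieAlg E G → G, IsDiffeoFromLieAlg Ψ ∧
    ∀ t : Fin n → ℝ, ∀ X ∈ 𝔥, Ψ (∑ i, t i • A i + X) = expProd A t * lieExp X

/-- `N₁, …, Nₘ` is a Malcev basis of `𝔥`: a basis of `𝔥` such that each of the subspaces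
`span {Nⱼ, …, Nₘ}` is a Lie subalgebra. -/
structure IsMalcevBasis {E : Type*} [NormedAddCommGroup E] [NormedSpace ℝ E] [CompleteSpace E]
    {G : Type*} [TopologicalSpace G] [ChartedSpace E G] [Group G] [LieGroup 𝓘(ℝ, E) ∞ G]
    (𝔥 : Submodule ℝ (LieAlg E G)) {m : ℕ} (N : Fin m → LieAlg E G) : Prop where
  linearIndependent : LinearIndependent ℝ N
  span_eq : Submodule.span ℝ (Set.range N) = 𝔥
  lie_mem : ∀ j : Fin m, ∀ X ∈ Submodule.span ℝ (N '' Set.Ici j),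
    ∀ Y ∈ Submodule.span ℝ (N '' Set.Ici j), ⁅X, Y⁆ ∈ Submodule.span ℝ (N '' Set.Ici j)

/-- The second-kind coordinate map attached to a basis `A₁, …, Aₙ, N₁, …, Nₘ` of `𝔤`:
`∑ tᵢ Aᵢ + ∑ sⱼ Nⱼ ↦ exp (t₁ A₁) ⋯ exp (tₙ Aₙ) exp (s₁ N₁) ⋯ exp (sₘ Nₘ)`. -/
def secondKindMap {E : Type*} [NormedAddCommGroup E] [NormedSpace ℝ E]
    {G : Type*} [TopologicalSpace G] [ChartedSpace E G] [Group G] {n m : ℕ}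
    (b : Module.Basis (Fin n ⊕ Fin m) ℝ (LieAlg E G)) (X : LieAlg E G) : G :=
  expProd (fun i => b (Sum.inl i)) (fun i => b.repr X (Sum.inl i)) *
    expProd (fun j => b (Sum.inr j)) (fun j => b.repr X (Sum.inr j))

end

noncomputable section

/-! Concatenate the two bases into `c` and let 𝔥_j be the span of the `c i` with i ≥ j (indices from
0). Each 𝔥_j is a subalgebra and `c j` normalizes 𝔥_{j+1}. Among the A's this holds because 𝔥_{j+1}
contains 𝔫. Among the N's, y ∈ 𝔥_{j+1} gives [y, c j] = a c j + z with z ∈ 𝔥_{j+1}; since y ∈ 𝔫,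
Lie's theorem makes ad y nilpotent, so a = 0 (`lie_basis_mem_span_tail`).

Hence the subgroups H_j = exp 𝔥_j satisfy H_j = exp(ℝ c_j) H_{j+1}, with exp(ℝ c_j) normalizing
H_{j+1}. Write g = exp(a c_0) h with h ∈ H_1. Moving h to the right past exp(s c_0) conjugates it
inside H_1, where induction absorbs it into the remaining coordinates; exp(a c_0) merely translates
s. So Lebesgue measure in these coordinates is left invariant (`lintegral_mul_ofFn_prod`). It is
Haar because the coordinate map is injective and sends the closed unit ball onto a compact
neighbourhood of 1, which therefore has finite nonzero measure.

The group facts are read in the global chart exp, without the Baker-Campbell-Hausdorff series: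
products of exponentials stay in exp 𝔥_j because they solve differential equations whose fields
preserve 𝔥_j (`mem_submodule_of_hasDerivAt`). `LogChart.ofDiffeo_ad` matches the chart's `ad` with
the Lie bracket. -/

/-- A group whose multiplication is smooth in a global chart `e : E ≃ G` for which the lines
through the origin are one-parameter subgroups. -/
structure LogChart (E : Type*) [NormedAddCommGroup E] [NormedSpace ℝ E]
    (G : Type*) [Group G] where
  /-- The exponential chart. -/
  e : E ≃ G
  contDiff_mul : ContDiff ℝ ∞ fun p : E × E => e.symm (e p.1 * e p.2)
  smul_mul_smul : ∀ (x : E) (s t : ℝ), e (s • x) * e (t • x) = e ((s + t) • x)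

/-! ### Group law and adjoint representation in logarithmic coordinates. -/

namespace LogChart

variable {E : Type*} [NormedAddCommGroup E] [NormedSpace ℝ E] {G : Type*} [Group G]
  (κ : LogChart E G)

theorem e_zero : κ.e 0 = 1 := by
  have h := κ.smul_mul_smul 0 0 0
  simpa using h

theorem symm_one : κ.e.symm 1 = 0 := by
  rw [← κ.e_zero, Equiv.symm_apply_apply]

theorem e_neg (x : E) : κ.e (-x) = (κ.e x)⁻¹ := by
  have h := κ.smul_mul_smul x (-1) 1
  rw [eq_inv_iff_mul_eq_one, ← κ.e_zero]
  simpa using h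

theorem e_nsmul (x : E) (n : ℕ) : κ.e ((n : ℝ) • x) = κ.e x ^ n := by
  induction n with
  | zero => simp [κ.e_zero]
  | succ n ih =>
    have h := κ.smul_mul_smul x n 1
    rw [ih, one_smul] at h
    rw [pow_succ, h]
    push_cast
    rfl

/-- The group law read in the chart. -/
def mul (x y : E) : E := κ.e.symm (κ.e x * κ.e y)

@[simp] theorem e_mul (x y : E) : κ.e (κ.mul x y) = κ.e x * κ.e y := by simp [mul]

theorem contDiff_mul' : ContDiff ℝ ∞ fun p : E × E => κ.mul p.1 p.2 := κ.contDiff_mul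

theorem _root_.ContDiff.logChart_mul {V : Type*} [NormedAddCommGroup V] [NormedSpace ℝ V]
    {f g : V → E} (hf : ContDiff ℝ ∞ f) (hg : ContDiff ℝ ∞ g) :
    ContDiff ℝ ∞ fun v => κ.mul (f v) (g v) :=
  κ.contDiff_mul'.comp (hf.prodMk hg)

theorem mul_zero (x : E) : κ.mul x 0 = x := by simp [mul, κ.e_zero]

theorem zero_mul (x : E) : κ.mul 0 x = x := by simp [mul, κ.e_zero]

theorem neg_mul (x : E) : κ.mul (-x) x = 0 := by simp [mul, κ.e_neg, κ.symm_one]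

theorem hasStrictFDerivAt_mul_zero :
    HasStrictFDerivAt (fun p : E × E => κ.mul p.1 p.2)
      (ContinuousLinearMap.fst ℝ E E + ContinuousLinearMap.snd ℝ E E) 0 := by
  have h := κ.contDiff_mul'.contDiffAt (x := (0 : E × E)) |>.hasStrictFDerivAt (by simp)
  set D := fderiv ℝ (fun p : E × E => κ.mul p.1 p.2) 0
  suffices ContinuousLinearMap.fst ℝ E E + ContinuousLinearMap.snd ℝ E E = D by rwa [this]
  have h1 : D ∘L ContinuousLinearMap.inl ℝ E E = ContinuousLinearMap.id ℝ E := by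
    have h2 : HasFDerivAt (fun x : E => κ.mul x 0) (D ∘L ContinuousLinearMap.inl ℝ E E) 0 :=
      HasFDerivAt.comp (f := fun x : E => (x, (0 : E))) 0 h.hasFDerivAt
        (hasFDerivAt_prodMk_left 0 0)
    simp only [mul_zero] at h2
    exact h2.unique (hasFDerivAt_id 0)
  have h2 : D ∘L ContinuousLinearMap.inr ℝ E E = ContinuousLinearMap.id ℝ E := by
    have h2 : HasFDerivAt (fun x : E => κ.mul 0 x) (D ∘L ContinuousLinearMap.inr ℝ E E) 0 :=
      HasFDerivAt.comp (f := fun x : E => ((0 : E), x)) 0 h.hasFDerivAt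
        (hasFDerivAt_prodMk_right 0 0)
    simp only [zero_mul] at h2
    exact h2.unique (hasFDerivAt_id 0)
  ext p
  · simpa using (congrArg (fun f => f p) h1).symm
  · simpa using (congrArg (fun f => f p) h2).symm

theorem hasFDerivAt_mul {V : Type*} [NormedAddCommGroup V] [NormedSpace ℝ V]
    {f g : V → E} {f' g' : V →L[ℝ] E} {v : V} (hf : HasFDerivAt f f' v) (hg : HasFDerivAt g g' v)
    (hf0 : f v = 0) (hg0 : g v = 0) :
    HasFDerivAt (fun w => κ.mul (f w) (g w)) (f' + g') v := by
  have h := κ.hasStrictFDerivAt_mul_zero.hasFDerivAt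
  have h0 : (0 : E × E) = (f v, g v) := by rw [hf0, hg0]; rfl
  rw [h0] at h
  have h1 := h.comp v (hf.prodMk hg)
  refine h1.congr_fderiv ?_
  ext
  simp

/-- Conjugation read in the chart. -/
def conj (g : G) (y : E) : E := κ.e.symm (g * κ.e y * g⁻¹)

@[simp] theorem e_conj (g : G) (y : E) : κ.e (κ.conj g y) = g * κ.e y * g⁻¹ := by simp [conj]

theorem conj_e (x y : E) : κ.conj (κ.e x) y = κ.mul (κ.mul x y) (-x) := by
  apply κ.e.injective
  simp [κ.e_neg]

theorem contDiff_conj_e : ContDiff ℝ ∞ fun p : E × E => κ.conj (κ.e p.1) p.2 := by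
  simp only [conj_e]
  exact (contDiff_fst.logChart_mul κ contDiff_snd).logChart_mul κ contDiff_fst.neg

theorem contDiff_conj (g : G) : ContDiff ℝ ∞ (κ.conj g) := by
  obtain ⟨x, rfl⟩ := κ.e.surjective g
  exact κ.contDiff_conj_e.comp (contDiff_const.prodMk contDiff_id)

theorem conj_zero (g : G) : κ.conj g 0 = 0 := by simp [conj, κ.e_zero, κ.symm_one]

theorem conj_nsmul (g : G) (n : ℕ) (y : E) : κ.conj g ((n : ℝ) • y) = (n : ℝ) • κ.conj g y := by
  apply κ.e.injective
  simp [κ.e_nsmul, conj_pow]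

/-- The adjoint representation. -/
def Ad (g : G) : E →L[ℝ] E := fderiv ℝ (κ.conj g) 0

/-- Conjugation commutes with powers, so n · conj(y/n) = conj(y) for every positive integer n;
letting n → ∞ identifies conj with its own derivative at 0. Thus conjugation is linear in this
chart. -/
theorem conj_eq_Ad (g : G) (y : E) : κ.conj g y = κ.Ad g y := by
  have h1 : HasFDerivAt (κ.conj g) (κ.Ad g) 0 :=
    ((κ.contDiff_conj g).differentiable (by simp) 0).hasFDerivAt
  have h2 : HasDerivAt (fun t : ℝ => κ.conj g (t • y)) (κ.Ad g y) 0 := by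
    have h3 : HasDerivAt (fun t : ℝ => t • y) y 0 := by
      simpa using (hasDerivAt_id (0 : ℝ)).smul_const y
    have h4 : HasFDerivAt (κ.conj g) (κ.Ad g) ((0 : ℝ) • y) := by simpa using h1
    exact h4.comp_hasDerivAt 0 h3
  have h5 := h2.tendsto_slope_zero
  simp only [zero_add, zero_smul, κ.conj_zero, sub_zero] at h5
  have h6 : Filter.Tendsto (fun n : ℕ => 1 / ((n : ℝ) + 1)) Filter.atTop (nhdsWithin 0 {0}ᶜ) := by
    apply tendsto_nhdsWithin_of_tendsto_nhds_of_eventually_within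
    · exact tendsto_one_div_add_atTop_nhds_zero_nat
    · exact Filter.Eventually.of_forall fun n => by
        simp only [Set.mem_compl_iff, Set.mem_singleton_iff]
        positivity
  refine tendsto_nhds_unique (tendsto_const_nhds.congr fun n => ?_) (h5.comp h6)
  have h7 : ((n : ℝ) + 1) ≠ 0 := by positivity
  have h8 := κ.conj_nsmul g (n + 1) ((1 / ((n : ℝ) + 1)) • y)
  push_cast at h8
  rw [smul_smul, mul_one_div_cancel h7, one_smul] at h8
  simp only [Function.comp_apply, one_div, inv_inv]
  simpa using h8

theorem e_Ad (g : G) (y : E) : κ.e (κ.Ad g y) = g * κ.e y * g⁻¹ := by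
  rw [← conj_eq_Ad, e_conj]

theorem Ad_mul (g h : G) : κ.Ad (g * h) = κ.Ad g ∘L κ.Ad h := by
  ext y
  apply κ.e.injective
  simp [e_Ad, mul_assoc]

theorem Ad_one : κ.Ad 1 = ContinuousLinearMap.id ℝ E := by
  ext y
  apply κ.e.injective
  simp [e_Ad]

variable [FiniteDimensional ℝ E]

theorem contDiff_Ad : ContDiff ℝ ∞ fun x : E => κ.Ad (κ.e x) := by
  rw [contDiff_clm_apply_iff]
  intro y
  simp only [← conj_eq_Ad]
  exact κ.contDiff_conj_e.comp (contDiff_id.prodMk contDiff_const)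

/-- The derivative of the adjoint representation. -/
def ad : E →L[ℝ] E →L[ℝ] E := fderiv ℝ (fun x : E => κ.Ad (κ.e x)) 0

theorem hasFDerivAt_Ad_zero : HasFDerivAt (fun x : E => κ.Ad (κ.e x)) κ.ad 0 :=
  (κ.contDiff_Ad.differentiable (by simp) 0).hasFDerivAt

theorem hasDerivAt_Ad_smul (x : E) (s : ℝ) :
    HasDerivAt (fun s : ℝ => κ.Ad (κ.e (s • x))) (κ.ad x ∘L κ.Ad (κ.e (s • x))) s := by
  have h1 : HasDerivAt (fun h : ℝ => κ.Ad (κ.e (h • x))) (κ.ad x) 0 := by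
    have h3 : HasDerivAt (fun t : ℝ => t • x) x 0 := by
      simpa using (hasDerivAt_id (0 : ℝ)).smul_const x
    have h4 : HasFDerivAt (fun x : E => κ.Ad (κ.e x)) κ.ad ((0 : ℝ) • x) := by
      simpa using κ.hasFDerivAt_Ad_zero
    exact h4.comp_hasDerivAt 0 h3
  have h2 : HasDerivAt (fun h : ℝ => κ.Ad (κ.e (h • x)) ∘L κ.Ad (κ.e (s • x)))
      (κ.ad x ∘L κ.Ad (κ.e (s • x))) 0 := by
    simpa using h1.clm_comp (hasDerivAt_const (0 : ℝ) (κ.Ad (κ.e (s • x))))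
  rw [← sub_self s] at h2
  have h5 := h2.comp_sub_const s s
  simpa [← Ad_mul, κ.smul_mul_smul] using h5

end LogChart

/-! ### Invariant subspaces of flows. -/

/-- A subspace preserved by a time-dependent locally Lipschitz vector field is invariant under
its flow. -/
theorem mem_submodule_of_hasDerivAt {E : Type*} [NormedAddCommGroup E] [NormedSpace ℝ E]
    [FiniteDimensional ℝ E] (W : Submodule ℝ E) {u : ℝ → E} {v : ℝ → E → E}
    (hu : ∀ s, HasDerivAt u (v s (u s)) s) (h0 : u 0 ∈ W)
    (hv : ∀ s, ∀ w ∈ W, v s w ∈ W)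
    (hL : ∀ R : ℝ, ∃ K : ℝ, ∀ s ∈ Set.Icc (0 : ℝ) 1, ∀ x ∈ Metric.closedBall (0 : E) R,
      ∀ y ∈ Metric.closedBall (0 : E) R, ‖v s x - v s y‖ ≤ K * ‖x - y‖) :
    u 1 ∈ W := by
  -- `P` projects onto a complement along `W`, so the goal becomes P (u 1) = 0, which Grönwall
  -- gives.
  obtain ⟨W', hW'⟩ := Submodule.exists_isCompl W
  let P : E →L[ℝ] E := LinearMap.toContinuousLinearMap (W'.subtype ∘ₗ W'.projectionOnto W hW'.symm)
  have hP0 : ∀ w, P w = 0 ↔ w ∈ W := fun w => by simp [P]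
  have hP1 : ∀ w, w - P w ∈ W := fun w => by
    rw [← hP0, map_sub, sub_eq_zero]
    simp only [P, LinearMap.coe_toContinuousLinearMap', LinearMap.comp_apply, Submodule.subtype_apply,
      Submodule.projectionOnto_apply_left]
  have hc : Continuous u := continuous_iff_continuousAt.2 fun s => (hu s).continuousAt
  obtain ⟨R1, hR1⟩ := (isCompact_Icc (a := (0 : ℝ)) (b := 1)).exists_bound_of_continuousOn
    hc.continuousOn
  obtain ⟨R2, hR2⟩ := (isCompact_Icc (a := (0 : ℝ)) (b := 1)).exists_bound_of_continuousOn
    (f := fun s => u s - P (u s)) (by fun_prop)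
  -- One ball must contain both u and its `W`-component u - P u, which are compared below.
  obtain ⟨K, hK⟩ := hL (max R1 R2)
  have key := norm_le_gronwallBound_of_norm_deriv_right_le (f := fun s => P (u s))
    (f' := fun s => P (v s (u s))) (δ := 0) (K := ‖P‖ * K) (ε := 0) (a := 0) (b := 1)
    (by fun_prop)
    (fun s _ => ((P.hasFDerivAt.comp_hasDerivAt s (hu s))).hasDerivWithinAt)
    (by simp [(hP0 _).2 h0]) (fun s hs => by
      have hs' := Set.Ico_subset_Icc_self hs
      have h1 : P (v s (u s)) = P (v s (u s) - v s (u s - P (u s))) := by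
        rw [map_sub, (hP0 _).2 (hv s _ (hP1 _)), sub_zero]
      have h2 := hK s hs' (u s) (by simpa using Or.inl (hR1 s hs')) (u s - P (u s))
        (by simpa using Or.inr (hR2 s hs'))
      rw [h1, add_zero, mul_assoc]
      refine (P.le_opNorm _).trans (mul_le_mul_of_nonneg_left ?_ (norm_nonneg _))
      simpa using h2) 1 (by simp)
  rw [gronwallBound_ε0_δ0] at key
  exact (hP0 _).1 (norm_le_zero_iff.1 key)

/-! ### Differential of the exponential, and exponentials of subalgebras. -/

namespace LogChart

variable {E : Type*} [NormedAddCommGroup E] [NormedSpace ℝ E]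
  {G : Type*} [Group G] (κ : LogChart E G)

/-- The differential at the origin of left translation, read in the chart. -/
def leftDeriv (x : E) : E →L[ℝ] E := fderiv ℝ (κ.mul x) 0

theorem contDiff_mul_right (x : E) : ContDiff ℝ ∞ (κ.mul x) :=
  contDiff_const.logChart_mul κ contDiff_id

theorem hasFDerivAt_leftDeriv (x : E) : HasFDerivAt (κ.mul x) (κ.leftDeriv x) 0 :=
  ((κ.contDiff_mul_right x).differentiable (by simp) 0).hasFDerivAt

theorem leftDeriv_zero : κ.leftDeriv 0 = ContinuousLinearMap.id ℝ E := by
  have : κ.mul 0 = id := funext κ.zero_mul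
  rw [leftDeriv, this, fderiv_id]

theorem contDiff_leftDeriv : ContDiff ℝ ∞ κ.leftDeriv :=
  ContDiff.fderiv (f := fun x y => κ.mul x y) (m := ∞) (n := ∞) (g := fun _ => 0)
    κ.contDiff_mul' contDiff_const le_rfl

/-- `t ↦ D_z (exp (-t x) exp (t z))` at `z = x`. -/
def expDeriv (x : E) (t : ℝ) : E →L[ℝ] E := fderiv ℝ (fun z => κ.mul (-(t • x)) (t • z)) x

theorem hasFDerivAt_expDeriv (x : E) (t : ℝ) :
    HasFDerivAt (fun z => κ.mul (-(t • x)) (t • z)) (κ.expDeriv x t) x :=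
  ((contDiff_const.logChart_mul κ (contDiff_const.smul contDiff_id)).differentiable
    (by simp) x).hasFDerivAt

/-- Cocycle identity: exp(-(t+u)x) exp((t+u)z) is the conjugate by exp(-tx) of exp(-ux) exp(uz),
times exp(-tx) exp(tz). It reduces differentiation in t to t = 0. -/
theorem expDeriv_add (x : E) (t u : ℝ) :
    κ.expDeriv x (t + u) = κ.Ad (κ.e (-(t • x))) ∘L κ.expDeriv x u + κ.expDeriv x t := by
  refine (κ.hasFDerivAt_expDeriv x (t + u)).unique ?_
  have h1 := κ.hasFDerivAt_mul
    ((κ.Ad (κ.e (-(t • x)))).hasFDerivAt.comp x (κ.hasFDerivAt_expDeriv x u))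
    (κ.hasFDerivAt_expDeriv x t) (by simp [κ.neg_mul]) (by simp [κ.neg_mul])
  refine h1.congr_of_eventuallyEq (Filter.Eventually.of_forall fun z => ?_)
  apply κ.e.injective
  simp only [e_mul, e_Ad, Function.comp_apply, e_neg]
  rw [add_comm t u, ← κ.smul_mul_smul x, ← κ.smul_mul_smul z]
  group

theorem hasDerivAt_expDeriv_zero (x : E) :
    HasDerivAt (κ.expDeriv x) (ContinuousLinearMap.id ℝ E) 0 := by
  let D : ℝ → E →L[ℝ] E := fun u => fderiv ℝ (κ.mul (-(u • x))) (u • x)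
  have hD : ContDiff ℝ ∞ D :=
    ContDiff.fderiv (f := fun (u : ℝ) z => κ.mul (-(u • x)) z) (m := ∞) (n := ∞)
      (ContDiff.logChart_mul κ (contDiff_fst.smul contDiff_const).neg contDiff_snd)
      (contDiff_id.smul contDiff_const) le_rfl
  -- The chain rule extracts a factor u, so the derivative at u = 0 is just `D 0`.
  have hJ : κ.expDeriv x = fun u => u • D u := by
    ext1 u
    refine (κ.hasFDerivAt_expDeriv x u).unique ?_
    have h1 : HasFDerivAt (κ.mul (-(u • x))) (D u) (u • x) :=
      ((κ.contDiff_mul_right _).differentiable (by simp) _).hasFDerivAt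
    have h2 : HasFDerivAt (fun z : E => u • z) (u • ContinuousLinearMap.id ℝ E) x :=
      (hasFDerivAt_id x).const_smul u
    refine (h1.comp x h2).congr_fderiv ?_
    ext
    simp
  have hD0 : D 0 = ContinuousLinearMap.id ℝ E := by
    have : κ.mul 0 = id := funext κ.zero_mul
    simp [D, this]
  rw [hJ]
  have h := (hasDerivAt_id (0 : ℝ)).smul (hD.differentiable (by simp) 0).hasDerivAt
  simp only [id, zero_smul, one_smul, zero_add, hD0] at h
  exact h

theorem hasDerivAt_expDeriv (x : E) (t : ℝ) :
    HasDerivAt (κ.expDeriv x) (κ.Ad (κ.e (-(t • x)))) t := by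
  have h2 := ((hasDerivAt_const (0 : ℝ) (κ.Ad (κ.e (-(t • x))))).clm_comp
    (κ.hasDerivAt_expDeriv_zero x)).add_const (κ.expDeriv x t)
  rw [← sub_self t] at h2
  have h5 := h2.comp_sub_const t t
  have h6 : (fun s : ℝ => κ.Ad (κ.e (-(t • x))) ∘L κ.expDeriv x (s - t) + κ.expDeriv x t) =
      κ.expDeriv x := by
    ext1 s
    rw [← expDeriv_add, add_sub_cancel]
  simpa [h6] using h5

theorem leftDeriv_comp_expDeriv (x : E) :
    κ.leftDeriv x ∘L κ.expDeriv x 1 = ContinuousLinearMap.id ℝ E := by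
  have h1 := κ.hasFDerivAt_expDeriv x 1
  have h2 : HasFDerivAt (κ.mul x) (κ.leftDeriv x) (κ.mul (-((1 : ℝ) • x)) ((1 : ℝ) • x)) := by
    rw [κ.neg_mul]; exact κ.hasFDerivAt_leftDeriv x
  refine (h2.comp x h1).unique ?_
  refine (hasFDerivAt_id x).congr_of_eventuallyEq (Filter.Eventually.of_forall fun z => ?_)
  apply κ.e.injective
  simp [e_neg]

theorem hasDerivAt_mul_leftDeriv {f : ℝ → E} {f' : E} (x : E) (h0 : f 0 = 0)
    (hf : HasDerivAt f f' 0) : HasDerivAt (fun h => κ.mul x (f h)) (κ.leftDeriv x f') 0 := by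
  have h1 := κ.hasFDerivAt_leftDeriv x
  rw [← h0] at h1
  exact h1.comp_hasDerivAt 0 hf

variable [FiniteDimensional ℝ E]

theorem Ad_mem {W : Submodule ℝ E} {x y : E} (hx : ∀ w ∈ W, κ.ad x w ∈ W) (hy : y ∈ W) :
    κ.Ad (κ.e x) y ∈ W := by
  have h := mem_submodule_of_hasDerivAt W (u := fun s : ℝ => κ.Ad (κ.e (s • x)) y)
    (v := fun _ w => κ.ad x w)
    (fun s => by simpa using (κ.hasDerivAt_Ad_smul x s).clm_apply (hasDerivAt_const s y))
    (by simpa [κ.e_zero, κ.Ad_one] using hy) (fun _ => hx)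
    (fun R => ⟨‖κ.ad x‖, fun s _ a _ b _ => by rw [← map_sub]; exact (κ.ad x).le_opNorm _⟩)
  simpa using h

theorem expDeriv_one_mem {W : Submodule ℝ E} {x y : E} (hx : ∀ w ∈ W, κ.ad x w ∈ W) (hy : y ∈ W) :
    κ.expDeriv x 1 y ∈ W := by
  refine mem_submodule_of_hasDerivAt W (u := fun s : ℝ => κ.expDeriv x s y)
    (v := fun s _ => κ.Ad (κ.e (-(s • x))) y)
    (fun s => by simpa using (κ.hasDerivAt_expDeriv x s).clm_apply (hasDerivAt_const s y))
    ?_ (fun s _ _ => ?_) (fun R => ⟨0, fun s _ a _ b _ => by simp⟩)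
  · have : κ.expDeriv x 0 = 0 := by
      simp [expDeriv]
    simp [this]
  · rw [← neg_smul]
    exact κ.Ad_mem (fun w hw => by simpa using W.smul_mem (-s) (hx w hw)) hy

/-- `expDeriv x 1` maps `W` injectively into itself, hence onto `W` by finite dimension; its left
inverse `leftDeriv x` then preserves `W` too. -/
theorem leftDeriv_mem {W : Submodule ℝ E} {x y : E} (hx : ∀ w ∈ W, κ.ad x w ∈ W) (hy : y ∈ W) :
    κ.leftDeriv x y ∈ W := by
  have hinv : ∀ w, κ.leftDeriv x (κ.expDeriv x 1 w) = w := fun w =>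
    congrArg (fun f => f w) (κ.leftDeriv_comp_expDeriv x)
  let f : W →ₗ[ℝ] W := (κ.expDeriv x 1 : E →ₗ[ℝ] E).restrict fun w hw => κ.expDeriv_one_mem hx hw
  have hf : Function.Injective f := by
    intro a b hab
    have h1 : κ.expDeriv x 1 a = κ.expDeriv x 1 b := congrArg Subtype.val hab
    apply Subtype.ext
    rw [← hinv a, h1, hinv]
  obtain ⟨w, hw⟩ := LinearMap.injective_iff_surjective.1 hf ⟨y, hy⟩
  have h1 : κ.expDeriv x 1 w = y := congrArg Subtype.val hw
  rw [← h1, hinv]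
  exact w.2

/-- A curve through the exponential of a subalgebra whose logarithmic derivative lies in the
subalgebra stays in the exponential of the subalgebra. -/
theorem mem_of_hasDerivAt_leftDeriv {W : Submodule ℝ E} (hW : ∀ x ∈ W, ∀ y ∈ W, κ.ad x y ∈ W)
    {u η : ℝ → E} (hη : Continuous η) (hηW : ∀ s, η s ∈ W) (h0 : u 0 ∈ W)
    (hu : ∀ s, HasDerivAt u (κ.leftDeriv (u s) (η s)) s) : u 1 ∈ W := by
  refine mem_submodule_of_hasDerivAt W (v := fun s w => κ.leftDeriv w (η s)) hu h0
    (fun s w hw => κ.leftDeriv_mem (hW w hw) (hηW s)) fun R => ?_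
  obtain ⟨C, hC⟩ := (isCompact_Icc (a := (0 : ℝ)) (b := 1)).exists_bound_of_continuousOn
    hη.continuousOn
  obtain ⟨K, hK⟩ := (isCompact_closedBall (0 : E) R).exists_bound_of_continuousOn
    (κ.contDiff_leftDeriv.continuous_fderiv (by simp)).continuousOn
  refine ⟨K * C, fun s hs x hx y hy => ?_⟩
  have h1 : ‖κ.leftDeriv x - κ.leftDeriv y‖ ≤ K * ‖x - y‖ :=
    (convex_closedBall (0 : E) R).norm_image_sub_le_of_norm_fderiv_le
      (fun z _ => κ.contDiff_leftDeriv.differentiable (by simp) z) hK hy hx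
  calc ‖κ.leftDeriv x (η s) - κ.leftDeriv y (η s)‖
      = ‖(κ.leftDeriv x - κ.leftDeriv y) (η s)‖ := by simp
    _ ≤ ‖κ.leftDeriv x - κ.leftDeriv y‖ * ‖η s‖ := ContinuousLinearMap.le_opNorm _ _
    _ ≤ K * ‖x - y‖ * C := mul_le_mul h1 (hC s hs) (norm_nonneg _) ((norm_nonneg _).trans h1)
    _ = K * C * ‖x - y‖ := by ring

/-- The curve s ↦ x · exp(sy) has constant logarithmic derivative y ∈ `W`. -/
theorem mul_mem {W : Submodule ℝ E} (hW : ∀ x ∈ W, ∀ y ∈ W, κ.ad x y ∈ W) {x y : E}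
    (hx : x ∈ W) (hy : y ∈ W) : κ.mul x y ∈ W := by
  have h := κ.mem_of_hasDerivAt_leftDeriv hW (u := fun s : ℝ => κ.mul x (s • y))
    (η := fun _ => y) continuous_const (fun _ => hy) (by simpa [κ.mul_zero] using hx) (fun s => ?_)
  · simpa using h
  have h3 : HasDerivAt (fun t : ℝ => t • y) y 0 := by
    simpa using (hasDerivAt_id (0 : ℝ)).smul_const y
  have h2 := κ.hasDerivAt_mul_leftDeriv (κ.mul x (s • y)) (by simp) h3
  rw [← sub_self s] at h2
  refine (h2.comp_sub_const s s).congr_of_eventuallyEq (Filter.Eventually.of_forall fun r => ?_)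
  apply κ.e.injective
  simp [mul_assoc, κ.smul_mul_smul]

/-- The curve exp(-sx) exp(s(x+z)) has logarithmic derivative Ad(exp(-s(x+z))) z ∈ `W`. This yields
exp(x+z) = exp(x) h with h ∈ exp `W`, for x merely normalizing `W`. -/
theorem neg_mul_add_mem {W : Submodule ℝ E} (hW : ∀ x ∈ W, ∀ y ∈ W, κ.ad x y ∈ W) {x z : E}
    (hx : ∀ w ∈ W, κ.ad x w ∈ W) (hz : z ∈ W) : κ.mul (-x) (x + z) ∈ W := by
  have hxz : ∀ s : ℝ, ∀ w ∈ W, κ.ad (-(s • (x + z))) w ∈ W := fun s w hw => by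
    simpa using W.neg_mem (W.smul_mem s (W.add_mem (hx w hw) (hW z hz w hw)))
  have h := κ.mem_of_hasDerivAt_leftDeriv hW (u := fun s : ℝ => κ.mul (-(s • x)) (s • (x + z)))
    (η := fun s => κ.Ad (κ.e (-(s • (x + z)))) z)
    ((κ.contDiff_Ad.continuous.comp (by fun_prop : Continuous fun s : ℝ => -(s • (x + z)))).clm_apply
      continuous_const)
    (fun s => κ.Ad_mem (hxz s) hz) (by simp [κ.zero_mul]) (fun s => ?_)
  · simpa using h
  have h3 : ∀ y : E, HasDerivAt (fun t : ℝ => t • y) y 0 := fun y => by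
    simpa using (hasDerivAt_id (0 : ℝ)).smul_const y
  have h4 : HasDerivAt (fun t : ℝ => κ.mul (-(t • x)) (t • (x + z))) z 0 := by
    have := κ.hasFDerivAt_mul (h3 x).neg.hasFDerivAt (h3 (x + z)).hasFDerivAt (by simp) (by simp)
    simpa using this.hasDerivAt
  have h5 := (κ.Ad (κ.e (-(s • (x + z))))).hasFDerivAt.comp_hasDerivAt 0 h4
  have h2 := κ.hasDerivAt_mul_leftDeriv (κ.mul (-(s • x)) (s • (x + z)))
    (by simp [κ.zero_mul]) h5
  rw [← sub_self s] at h2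
  refine (h2.comp_sub_const s s).congr_of_eventuallyEq (Filter.Eventually.of_forall fun r => ?_)
  apply κ.e.injective
  have h6 : ∀ y, κ.e (r • y) = κ.e (s • y) * κ.e ((r - s) • y) := fun y => by
    rw [κ.smul_mul_smul, add_sub_cancel]
  have h7 : κ.e (r • x) = κ.e ((r - s) • x) * κ.e (s • x) := by
    rw [κ.smul_mul_smul, sub_add_cancel]
  have h8 : κ.e (r • (x + z)) = κ.e ((r - s) • (x + z)) * κ.e (s • (x + z)) := by
    rw [κ.smul_mul_smul, sub_add_cancel]
  simp only [e_mul, e_Ad, e_neg, Function.comp_apply]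
  rw [h7, h8]
  group

end LogChart

/-! ### Ordered products of one-parameter subgroups. -/

section OrderedProduct

variable {G : Type*} [Group G]

open MeasureTheory in
/-- Lebesgue measure in coordinates of the second kind is left invariant under the
group `H 0`, when each one-parameter group `e i` normalizes `H (i + 1)` and
`H i = e i ℝ * H (i + 1)`. -/
theorem lintegral_mul_ofFn_prod [MeasurableSpace G] [MeasurableMul₂ G] {k : ℕ}
    (e : Fin k → ℝ → G) (H : ℕ → Set G)
    (he : ∀ i s t, e i s * e i t = e i (s + t)) (hm : ∀ i, Measurable (e i))
    (hdec : ∀ i : Fin k, ∀ g ∈ H i, ∃ a, ∃ h ∈ H (i + 1), g = e i a * h)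
    (hn : ∀ (i : Fin k) t, ∀ g ∈ H (i + 1), (e i t)⁻¹ * g * e i t ∈ H (i + 1))
    (hlast : ∀ g ∈ H k, g = 1) {g : G} (hg : g ∈ H 0) {f : G → ENNReal} (hf : Measurable f) :
    ∫⁻ t : Fin k → ℝ, f (g * (List.ofFn fun i => e i (t i)).prod) =
      ∫⁻ t : Fin k → ℝ, f (List.ofFn fun i => e i (t i)).prod := by
  have hmeas : ∀ (k : ℕ) (e : Fin k → ℝ → G), (∀ i, Measurable (e i)) →
      Measurable fun t : Fin k → ℝ => (List.ofFn fun i => e i (t i)).prod := by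
    intro k e hm
    induction k with
    | zero => simp
    | succ k ih =>
      simp only [List.ofFn_succ, List.prod_cons]
      exact ((hm 0).comp (measurable_pi_apply 0)).mul
        ((ih (fun i => e i.succ) fun i => hm _).comp
          (measurable_pi_lambda (fun (t : Fin (k + 1) → ℝ) (i : Fin k) => t i.succ)
            fun i => measurable_pi_apply _))
  induction k generalizing H g f with
  | zero => simp [hlast g hg]
  | succ k ih =>
    have split : ∀ F : ℝ → (Fin k → ℝ) → ENNReal, Measurable (Function.uncurry F) →
        ∫⁻ t : Fin (k + 1) → ℝ, F (t 0) (fun i => t i.succ) = ∫⁻ s, ∫⁻ t, F s t := by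
      intro F hF
      have h1 := (volume_preserving_piFinSuccAbove (fun _ : Fin (k + 1) => ℝ) 0).lintegral_comp hF
      rw [Measure.volume_eq_prod, lintegral_prod _ hF.aemeasurable] at h1
      simpa [Function.uncurry, Fin.removeNth] using! h1
    set Q : (Fin k → ℝ) → G := fun t => (List.ofFn fun i => e i.succ (t i)).prod
    have hQ : Measurable Q := hmeas k (fun i => e i.succ) fun i => hm _
    obtain ⟨a, h, hh, rfl⟩ := hdec 0 g hg
    have hm0 : Measurable fun p : ℝ × (Fin k → ℝ) => e 0 p.1 * Q p.2 :=
      ((hm 0).comp measurable_fst).mul (hQ.comp measurable_snd)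
    simp only [List.ofFn_succ, List.prod_cons]
    -- Fubini isolates the first coordinate; translating it by a on the right-hand side prepares for
    -- e(a) e(s) = e(a + s).
    rw [split (fun s t => f (e 0 a * h * (e 0 s * Q t))) (hf.comp (hm0.const_mul _)),
      split (fun s t => f (e 0 s * Q t)) (hf.comp hm0),
      ← lintegral_add_left_eq_self (μ := volume) (fun s => ∫⁻ t, f (e 0 s * Q t)) a]
    congr 1
    ext1 s
    -- The induction hypothesis is applied to the conjugate of h by e(s), which lies in the next
    -- group.
    have key := ih (fun i => e i.succ) (fun j => H (j + 1)) (fun i => he _) (fun i => hm _)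
      (fun i => hdec i.succ) (fun i => hn i.succ) hlast (hn 0 s h hh)
      (f := fun x => f (e 0 (a + s) * x)) (hf.comp (measurable_const_mul _))
    rw [← key]
    congr 1
    ext1 t
    rw [← he]
    congr 1
    simp only [Q]
    group

theorem List.ofFn_prod_mem {k : ℕ} (e : Fin k → ℝ → G) (H : ℕ → Subgroup G)
    (hH : Antitone H) (hmem : ∀ (i : Fin k) t, e i t ∈ H i) (t : Fin k → ℝ) :
    (List.ofFn fun i => e i (t i)).prod ∈ H 0 := by
  refine Subgroup.list_prod_mem _ fun x hx => ?_
  obtain ⟨i, rfl⟩ := List.mem_ofFn.1 hx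
  exact hH (Nat.zero_le _) (hmem i _)

/-- If two products agree, e 0 (s 0 - t 0) is a quotient of two tails and lies in `H 1`, so the
first coordinates agree; cancel and repeat. -/
theorem List.ofFn_prod_injective {k : ℕ} (e : Fin k → ℝ → G) (H : ℕ → Subgroup G)
    (hH : Antitone H) (he : ∀ i s t, e i s * e i t = e i (s + t))
    (hmem : ∀ (i : Fin k) t, e i t ∈ H i)
    (hinj : ∀ (i : Fin k) t, e i t ∈ H (i + 1) → t = 0) :
    Function.Injective fun t : Fin k → ℝ => (List.ofFn fun i => e i (t i)).prod := by
  induction k generalizing H with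
  | zero => exact Function.injective_of_subsingleton _
  | succ k ih =>
    intro s t hst
    simp only [List.ofFn_succ, List.prod_cons] at hst
    have hP : ∀ t : Fin (k + 1) → ℝ, (List.ofFn fun i : Fin k => e i.succ (t i.succ)).prod ∈ H 1 :=
      fun t => List.ofFn_prod_mem (fun i : Fin k => e i.succ) (fun j => H (j + 1))
        (fun a b hab => hH (by omega)) (fun i => hmem i.succ) (fun i => t i.succ)
    have hz : ∀ r, e 0 (-r) = (e 0 r)⁻¹ := fun r => by
      have h1 : e 0 0 = 1 := by simpa using he 0 0 0
      rw [eq_inv_iff_mul_eq_one, he, neg_add_cancel, h1]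
    have h0 : s 0 = t 0 := by
      have h1 : e 0 (-t 0 + s 0) ∈ H 1 := by
        rw [← he, hz]
        have h2 : (e 0 (t 0))⁻¹ * e 0 (s 0) =
            (List.ofFn fun i : Fin k => e i.succ (t i.succ)).prod *
            ((List.ofFn fun i : Fin k => e i.succ (s i.succ)).prod)⁻¹ := by
          rw [inv_mul_eq_iff_eq_mul, ← mul_assoc, eq_mul_inv_iff_mul_eq, hst]
        rw [h2]
        exact (H 1).mul_mem (hP t) ((H 1).inv_mem (hP s))
      have := hinj 0 _ h1
      linarith
    rw [h0, mul_right_inj] at hst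
    have h1 := ih (fun i : Fin k => e i.succ) (fun j => H (j + 1)) (fun a b hab => hH (by omega))
      (fun i => he _) (fun i => hmem i.succ) (fun i => hinj i.succ) hst
    ext i
    refine Fin.cases h0 (fun j => congrFun h1 j) i

end OrderedProduct

/-! ### Haar measure in second-kind coordinates along a chain of subalgebras. -/

namespace LogChart

variable {E : Type*} [NormedAddCommGroup E] [NormedSpace ℝ E]
  {G : Type*} [Group G] (κ : LogChart E G)

theorem hasStrictFDerivAt_ofFn_prod {V : Type*} [NormedAddCommGroup V] [NormedSpace ℝ V] {k : ℕ}
    (f : Fin k → V → E) (f' : Fin k → V →L[ℝ] E) (v : V) (h0 : ∀ i, f i v = 0)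
    (hf : ∀ i, HasStrictFDerivAt (f i) (f' i) v) :
    HasStrictFDerivAt (fun w => κ.e.symm (List.ofFn fun i => κ.e (f i w)).prod) (∑ i, f' i) v := by
  induction k with
  | zero => simpa using hasStrictFDerivAt_const _ _
  | succ k ih =>
    have h1 := ih (fun i => f i.succ) (fun i => f' i.succ) (fun i => h0 _) (fun i => hf _)
    have h2 : κ.e.symm (List.ofFn fun i : Fin k => κ.e (f i.succ v)).prod = 0 := by
      simp [h0, κ.e_zero, κ.symm_one]
    have h := κ.hasStrictFDerivAt_mul_zero
    have h00 : (0 : E × E) =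
        (f 0 v, κ.e.symm (List.ofFn fun i : Fin k => κ.e (f i.succ v)).prod) := by
      rw [h0, h2]; rfl
    rw [h00] at h
    have h3 := h.comp v ((hf 0).prodMk h1)
    rw [Fin.sum_univ_succ]
    simp only [List.ofFn_succ, List.prod_cons]
    have h4 : (ContinuousLinearMap.fst ℝ E E + ContinuousLinearMap.snd ℝ E E) ∘L
        (f' 0).prod (∑ i : Fin k, f' i.succ) = f' 0 + ∑ i : Fin k, f' i.succ := by
      ext; simp
    rw [h4] at h3
    simpa [Function.comp_def, mul] using h3

theorem continuous_ofFn_prod [TopologicalSpace G] [IsTopologicalGroup G] (hκ : Continuous κ.e)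
    {N : ℕ} (c : Fin N → E) :
    Continuous fun t : Fin N → ℝ => (List.ofFn fun i => κ.e (t i • c i)).prod := by
  simp only [List.ofFn_eq_map]
  exact continuous_list_prod _ fun i _ => hκ.comp (by fun_prop)

variable [FiniteDimensional ℝ E]

/-- The exponential of a subalgebra. -/
def expSubgroup (W : Submodule ℝ E) (hW : ∀ x ∈ W, ∀ y ∈ W, κ.ad x y ∈ W) : Subgroup G where
  carrier := {g | κ.e.symm g ∈ W}
  mul_mem' {a b} ha hb := by simpa [mul] using κ.mul_mem hW ha hb
  one_mem' := by simp [κ.symm_one]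
  inv_mem' {a} ha := by
    have : κ.e.symm a⁻¹ = -κ.e.symm a := by
      apply κ.e.injective
      simp [κ.e_neg]
    simpa [this] using ha

theorem mem_expSubgroup {W : Submodule ℝ E} {hW : ∀ x ∈ W, ∀ y ∈ W, κ.ad x y ∈ W} {g : G} :
    g ∈ κ.expSubgroup W hW ↔ κ.e.symm g ∈ W := Iff.rfl

open MeasureTheory in
theorem isHaarMeasure_map_ofFn_prod [TopologicalSpace G] [IsTopologicalGroup G] [T2Space G]
    [SecondCountableTopology G] [MeasurableSpace G] [BorelSpace G]
    (hκ : Continuous κ.e) (hκ' : Continuous κ.e.symm) {N : ℕ} (c : Module.Basis (Fin N) ℝ E)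
    (hsub : ∀ j : ℕ, ∀ x ∈ Submodule.span ℝ (c '' {i | j ≤ i}),
      ∀ y ∈ Submodule.span ℝ (c '' {i | j ≤ i}), κ.ad x y ∈ Submodule.span ℝ (c '' {i | j ≤ i}))
    (hideal : ∀ j : Fin N, ∀ y ∈ Submodule.span ℝ (c '' {i | (j : ℕ) + 1 ≤ i}),
      κ.ad (c j) y ∈ Submodule.span ℝ (c '' {i | (j : ℕ) + 1 ≤ i})) :
    ((volume : Measure (Fin N → ℝ)).map
      fun t => (List.ofFn fun i => κ.e (t i • c i)).prod).IsHaarMeasure := by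
  set 𝔥 : ℕ → Submodule ℝ E := fun j => Submodule.span ℝ (c '' {i | j ≤ i})
  let H : ℕ → Subgroup G := fun j => κ.expSubgroup (𝔥 j) (hsub j)
  let Φ : (Fin N → ℝ) → G := fun t => (List.ofFn fun i => κ.e (t i • c i)).prod
  have hadd : ∀ i s t, κ.e (s • c i) * κ.e (t • c i) = κ.e ((s + t) • c i) :=
    fun i s t => κ.smul_mul_smul _ _ _
  have h𝔥 : Antitone 𝔥 := fun a b hab =>
    Submodule.span_mono (Set.image_mono fun i hi => le_trans hab hi)
  have hmem𝔥 : ∀ i : Fin N, c i ∈ 𝔥 i := fun i => Submodule.subset_span ⟨i, le_refl (i : ℕ), rfl⟩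
  have hnot : ∀ i : Fin N, c i ∉ 𝔥 (i + 1) := fun i =>
    c.linearIndependent.notMem_span_image fun h => by
      simp at h
  have hcont : ∀ i, Continuous fun t : ℝ => κ.e (t • c i) := fun i => hκ.comp (by fun_prop)
  have hΦc : Continuous Φ := κ.continuous_ofFn_prod hκ c
  have hΦinj : Function.Injective Φ := by
    refine List.ofFn_prod_injective (fun i t => κ.e (t • c i)) H ?_ hadd ?_ ?_
    · intro a b hab g hg
      exact h𝔥 hab hg
    · intro i t
      simpa [H, mem_expSubgroup] using (𝔥 i).smul_mem t (hmem𝔥 i)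
    · intro i t ht
      rw [mem_expSubgroup, Equiv.symm_apply_apply] at ht
      by_contra h0
      exact hnot i (by simpa [smul_smul, h0] using (𝔥 (i + 1)).smul_mem t⁻¹ ht)
  have hinv : ∀ (g : G) (f : G → ENNReal), Measurable f → ∫⁻ t, f (g * Φ t) = ∫⁻ t, f (Φ t) := by
    intro g f hf
    refine lintegral_mul_ofFn_prod (fun i t => κ.e (t • c i)) (fun j => (H j : Set G)) hadd
      (fun i => (hcont i).measurable) ?_ ?_ ?_ ?_ hf
    · intro i g hg
      have hg' : κ.e.symm g ∈ 𝔥 i := hg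
      have hset : {j : Fin N | (i : ℕ) ≤ j} = insert i {j : Fin N | (i : ℕ) + 1 ≤ j} := by
        ext j
        simp only [Set.mem_ofPred_eq, Set.mem_insert_iff, Fin.ext_iff]
        omega
      simp only [𝔥, hset, Set.image_insert_eq, Submodule.mem_span_insert] at hg'
      obtain ⟨a, z, hz, hgz⟩ := hg'
      -- With log g = a c_i + z, the second factor is exp(-a c_i) exp(a c_i + z).
      refine ⟨a, κ.e (κ.mul (-(a • c i)) (a • c i + z)), ?_, ?_⟩
      · change κ.e.symm _ ∈ 𝔥 (i + 1)
        rw [Equiv.symm_apply_apply]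
        exact κ.neg_mul_add_mem (hsub _)
          (fun w hw => by
            rw [map_smul, _root_.smul_apply]
            exact (𝔥 (i + 1)).smul_mem a (hideal i w hw)) hz
      · rw [← hgz]
        simp [κ.e_neg]
    · intro i t g hg
      change κ.e.symm _ ∈ 𝔥 (i + 1)
      have h1 := κ.e_Ad (κ.e ((-t) • c i)) (κ.e.symm g)
      have h2 : (κ.e (t • c i))⁻¹ * g * κ.e (t • c i) = κ.e (κ.Ad (κ.e ((-t) • c i)) (κ.e.symm g)) := by
        rw [h1, neg_smul, κ.e_neg]
        simp
      simp only [h2, Equiv.symm_apply_apply]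
      exact κ.Ad_mem (fun w hw => by
        simpa using (𝔥 (i + 1)).smul_mem t (hideal i w hw)) hg
    · intro g hg
      have hg' : κ.e.symm g ∈ 𝔥 N := hg
      have hset : {j : Fin N | N ≤ (j : ℕ)} = ∅ := by
        ext j
        simp
      simp only [𝔥, hset, Set.image_empty, Submodule.span_empty, Submodule.mem_bot] at hg'
      rw [← κ.e.apply_symm_apply g, hg', κ.e_zero]
    · change κ.e.symm g ∈ 𝔥 0
      simp [𝔥]
  have hleft : ((volume : Measure (Fin N → ℝ)).map Φ).IsMulLeftInvariant := by
    refine ⟨fun g => ?_⟩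
    ext s hs
    have h1 := hinv g (s.indicator 1) (measurable_one.indicator hs)
    rw [← lintegral_map (f := s.indicator 1) (g := fun t => g * Φ t)
        (measurable_one.indicator hs) (hΦc.measurable.const_mul g),
      ← lintegral_map (f := s.indicator 1) (g := Φ) (measurable_one.indicator hs) hΦc.measurable,
      lintegral_indicator_one hs, lintegral_indicator_one hs] at h1
    rw [← h1, Measure.map_map (measurable_const_mul g) hΦc.measurable]
    rfl
  -- At 0 the product differentiates to the sum of its factors, i.e. to the linear isomorphism given
  -- by the basis; the inverse function theorem then makes the image of the ball a neighbourhood of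
  -- 1.
  have hder : HasStrictFDerivAt (fun t => κ.e.symm (Φ t))
      (c.equivFun.symm.toContinuousLinearEquiv : (Fin N → ℝ) →L[ℝ] E) 0 := by
    have h1 := κ.hasStrictFDerivAt_ofFn_prod (V := Fin N → ℝ) (fun i t => t i • c i)
      (fun i => (ContinuousLinearMap.proj (R := ℝ) i).smulRight (c i)) 0 (by simp)
      (fun i => ((ContinuousLinearMap.proj (R := ℝ) (φ := fun _ : Fin N => ℝ) i).smulRight
        (c i)).hasStrictFDerivAt)
    refine h1.congr_fderiv (ContinuousLinearMap.ext fun t => ?_)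
    simp [Module.Basis.equivFun_symm_apply]
  set V : Set (Fin N → ℝ) := Metric.closedBall 0 1
  have hΦ0 : κ.e.symm (Φ 0) = 0 := by simp [Φ, κ.e_zero, κ.symm_one]
  have hnhds : (fun t => κ.e.symm (Φ t)) '' V ∈ nhds (0 : E) := by
    have h1 := hder.map_nhds_eq_of_equiv
    rw [hΦ0] at h1
    rw [← h1]
    exact Filter.image_mem_map (Metric.closedBall_mem_nhds _ one_pos)
  have hK : Φ '' V ∈ nhds (1 : G) := by
    have h1 := hκ'.continuousAt (x := 1)
    rw [ContinuousAt, κ.symm_one] at h1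
    filter_upwards [h1 hnhds]
    rintro g ⟨t, ht, htg⟩
    exact ⟨t, ht, κ.e.symm.injective htg⟩
  have hKc : IsCompact (Φ '' V) := (isCompact_closedBall _ _).image hΦc
  have hmeas : (volume : Measure (Fin N → ℝ)).map Φ (Φ '' V) = volume V := by
    rw [Measure.map_apply hΦc.measurable hKc.measurableSet, hΦinj.preimage_image]
  refine Measure.isHaarMeasure_of_isCompact_nonempty_interior _ (Φ '' V) hKc
    ⟨1, mem_interior_iff_mem_nhds.2 hK⟩ ?_ ?_
  · rw [hmeas]
    exact (Metric.measure_closedBall_pos _ _ one_pos).ne'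
  · rw [hmeas]
    exact (isCompact_closedBall _ _).measure_lt_top.ne

end LogChart

/-! ### Lie's theorem and ad-nilpotency of the derived algebra. -/

section Solvable

open LieAlgebra LieModule
open scoped TensorProduct

/-- On a common eigenvector a bracket acts as a commutator of scalars, hence by 0. -/
theorem LieModule.weight_apply_eq_zero_of_mem_lie_top {k L V : Type*} [Field k] [LieRing L]
    [LieAlgebra k L] [AddCommGroup V] [Module k V] [LieRingModule L V] [LieModule k L V]
    (χ : Module.Dual k L) {v : V} (hv : v ∈ weightSpace V χ) (hv0 : v ≠ 0) {x : L}
    (hx : x ∈ ⁅(⊤ : LieIdeal k L), (⊤ : LieIdeal k L)⁆) : χ x = 0 := by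
  have hx' : x ∈ ⁅(⊤ : LieIdeal k L), (⊤ : LieIdeal k L)⁆.toSubmodule := hx
  rw [LieSubmodule.lieIdeal_oper_eq_linear_span'] at hx'
  suffices Submodule.span k _ ≤ LinearMap.ker χ from this hx'
  rw [Submodule.span_le]
  rintro _ ⟨a, -, b, -, rfl⟩
  rw [mem_weightSpace] at hv
  have h1 : χ ⁅a, b⁆ • v = 0 := by
    rw [← hv, lie_lie, hv b, hv a, lie_smul, lie_smul, hv a, hv b, smul_smul, smul_smul,
      mul_comm, sub_self]
  simpa [hv0] using h1

/-- The derived algebra of a solvable Lie algebra acts by nilpotent endomorphisms. -/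
theorem LieModule.isNilpotent_toEnd_of_isAlgClosed {k L : Type*} [Field k] [CharZero k]
    [IsAlgClosed k] [LieRing L] [LieAlgebra k L] [IsSolvable L] {x : L}
    (hx : x ∈ ⁅(⊤ : LieIdeal k L), (⊤ : LieIdeal k L)⁆)
    (V : Type*) [AddCommGroup V] [Module k V] [LieRingModule L V] [LieModule k L V]
    [Module.Finite k V] : _root_.IsNilpotent (toEnd k L V x) := by
  induction hd : Module.finrank k V using Nat.strong_induction_on generalizing V with
  | _ d ih =>
    subst hd
    rcases subsingleton_or_nontrivial V with hV | hV
    · exact ⟨1, by ext v; exact Subsingleton.elim _ _⟩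
    -- Lie's theorem supplies a nonzero weight space; x kills it and is nilpotent on the quotient by
    -- induction on dimension.
    obtain ⟨χ, hχ⟩ := exists_nontrivial_weightSpace_of_isSolvable k L V
    obtain ⟨⟨v, hv⟩, hv0⟩ := exists_ne (0 : weightSpace V χ)
    have hv0' : v ≠ 0 := fun h => hv0 (Subtype.ext h)
    have hχx := weight_apply_eq_zero_of_mem_lie_top χ hv hv0' hx
    have hlt : Module.finrank k (V ⧸ weightSpace V χ) < Module.finrank k V := by
      have h1 := Submodule.finrank_quotient_add_finrank (weightSpace V χ).toSubmodule
      have h2 : 0 < Module.finrank k (weightSpace V χ).toSubmodule :=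
        Module.finrank_pos_iff.2 hχ
      have h3 : Module.finrank k (V ⧸ weightSpace V χ) =
        Module.finrank k (V ⧸ (weightSpace V χ).toSubmodule) := rfl
      omega
    obtain ⟨n, hn⟩ := ih _ hlt (V ⧸ weightSpace V χ) rfl
    refine ⟨n + 1, ?_⟩
    have hpow : ∀ (n : ℕ) (w : V), LieSubmodule.Quotient.mk' (weightSpace V χ)
        ((toEnd k L V x ^ n) w) = (toEnd k L (V ⧸ weightSpace V χ) x ^ n)
          (LieSubmodule.Quotient.mk' (weightSpace V χ) w) := by
      intro n
      induction n with
      | zero => simp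
      | succ n ihn =>
        intro w
        rw [pow_succ, pow_succ, Module.End.mul_apply, Module.End.mul_apply, ihn]
        rfl
    ext w
    have h1 : (toEnd k L V x ^ n) w ∈ weightSpace V χ := by
      rw [← LieSubmodule.Quotient.mk_eq_zero', ← LieSubmodule.Quotient.mk'_apply, hpow, hn]
      rfl
    rw [mem_weightSpace] at h1
    rw [pow_succ', Module.End.mul_apply, toEnd_apply_apply, h1, hχx]
    simp

/-- In a solvable Lie algebra in characteristic zero, the elements of the derived algebra are
ad-nilpotent. -/
theorem LieAlgebra.isNilpotent_ad_of_mem_lie_top {k L : Type*} [Field k] [CharZero k] [LieRing L]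
    [LieAlgebra k L] [Module.Finite k L] [IsSolvable L] {x : L}
    (hx : x ∈ ⁅(⊤ : LieIdeal k L), (⊤ : LieIdeal k L)⁆) :
    _root_.IsNilpotent (LieAlgebra.ad k L x) := by
  -- Lie's theorem needs an algebraically closed field; nilpotency descends because base change of
  -- endomorphisms is injective.
  let A := AlgebraicClosure k
  have hx' : (1 : A) ⊗ₜ[k] x ∈ ⁅(⊤ : LieIdeal A (A ⊗[k] L)), (⊤ : LieIdeal A (A ⊗[k] L))⁆ := by
    have h := LieSubmodule.tmul_mem_baseChange_of_mem (1 : A) hx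
    rwa [LieSubmodule.lie_baseChange, LieSubmodule.baseChange_top] at h
  have hn := LieModule.isNilpotent_toEnd_of_isAlgClosed hx' (A ⊗[k] L)
  have hbc_inj : Function.Injective (Module.End.baseChangeHom k A L) :=
    LinearMap.baseChangeHom_injective k L A
  rw [← IsNilpotent.map_iff hbc_inj]
  rwa [LieModule.toEnd_baseChange] at hn

/-- Modulo `W`, x is a nonzero eigenvector of the nilpotent map ad y with eigenvalue a. -/
theorem LieAlgebra.eq_zero_of_lie_eq_smul_add {k L : Type*} [Field k] [LieRing L]
    [LieAlgebra k L] {W : Submodule k L} {x y z : L} {a : k}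
    (hy : _root_.IsNilpotent (LieAlgebra.ad k L y)) (hW : ∀ w ∈ W, ⁅y, w⁆ ∈ W) (hx : x ∉ W)
    (hz : z ∈ W) (h : ⁅y, x⁆ = a • x + z) : a = 0 := by
  obtain ⟨n, hn⟩ := hy
  have key : ∀ n : ℕ, (LieAlgebra.ad k L y ^ n) x - a ^ n • x ∈ W := by
    intro n
    induction n with
    | zero => simp
    | succ n ih =>
      have h1 := W.add_mem (hW _ ih) (W.smul_mem (a ^ n) hz)
      rw [lie_sub, lie_smul, h, smul_add, smul_smul, ← pow_succ] at h1
      rw [pow_succ', Module.End.mul_apply, ad_apply]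
      convert h1 using 1
      abel
  have h1 := key n
  rw [hn] at h1
  by_contra h0
  apply hx
  have h2 := W.smul_mem (-(a ^ n)⁻¹) h1
  simpa [smul_smul, pow_ne_zero n h0] using h2

end Solvable

/-! ### The chain of spans of tails of the concatenated basis. -/

section TailSpan

variable {k L : Type*} [Field k] [LieRing L] [LieAlgebra k L] {n m : ℕ} (b : Module.Basis (Fin n ⊕ Fin m) k L)

theorem lie_top_le_span_tail
    (hD : Submodule.span k (Set.range fun j => b (Sum.inr j)) =
    ⁅(⊤ : LieIdeal k L), (⊤ : LieIdeal k L)⁆.toSubmodule)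
    {j : ℕ} (hj : j ≤ n) :
    ⁅(⊤ : LieIdeal k L), (⊤ : LieIdeal k L)⁆.toSubmodule ≤
      Submodule.span k (b.reindex finSumFinEquiv '' {i | j ≤ i}) := by
  rw [← hD]
  refine Submodule.span_mono ?_
  rintro _ ⟨i, rfl⟩
  exact ⟨finSumFinEquiv (Sum.inr i), by simp; omega, by simp⟩

theorem span_tail_add (j : ℕ) :
    Submodule.span k (b.reindex finSumFinEquiv '' {i | n + j ≤ i}) =
      Submodule.span k ((fun j => b (Sum.inr j)) '' {i | j ≤ i}) := by
  congr 1
  ext x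
  constructor
  · rintro ⟨i, hi, rfl⟩
    obtain ⟨i | i, rfl⟩ := finSumFinEquiv.surjective i
    · simp at hi
      omega
    · exact ⟨i, by simpa using hi, by simp⟩
  · rintro ⟨i, hi, rfl⟩
    exact ⟨finSumFinEquiv (Sum.inr i), by simpa using hi, by simp⟩

theorem lie_mem_span_tail
    (hD : Submodule.span k (Set.range fun j => b (Sum.inr j)) =
    ⁅(⊤ : LieIdeal k L), (⊤ : LieIdeal k L)⁆.toSubmodule)
    (hlie : ∀ j : Fin m, ∀ x ∈ Submodule.span k ((fun j => b (Sum.inr j)) '' Set.Ici j),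
    ∀ y ∈ Submodule.span k ((fun j => b (Sum.inr j)) '' Set.Ici j),
      ⁅x, y⁆ ∈ Submodule.span k ((fun j => b (Sum.inr j)) '' Set.Ici j))
    (j : ℕ) {x y : L}
    (hx : x ∈ Submodule.span k (b.reindex finSumFinEquiv '' {i | j ≤ i}))
    (hy : y ∈ Submodule.span k (b.reindex finSumFinEquiv '' {i | j ≤ i})) :
    ⁅x, y⁆ ∈ Submodule.span k (b.reindex finSumFinEquiv '' {i | j ≤ i}) := by
  rcases le_total j n with hj | hj
  · exact lie_top_le_span_tail b hD hj
      (LieSubmodule.lie_mem_lie (LieSubmodule.mem_top _) (LieSubmodule.mem_top _))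
  obtain ⟨j, rfl⟩ := Nat.exists_eq_add_of_le hj
  rw [span_tail_add] at hx hy ⊢
  rcases lt_or_ge j m with hjm | hjm
  · exact hlie ⟨j, hjm⟩ x hx y hy
  · have : {i : Fin m | j ≤ i} = ∅ := by
      ext i
      simp
      omega
    rw [this, Set.image_empty, Submodule.span_empty, Submodule.mem_bot] at hx ⊢
    rw [hx, zero_lie]

/-- The Malcev condition alone only makes consecutive tails subalgebras; ad-nilpotency on 𝔫 upgrades
each to an ideal in the preceding one. -/
theorem lie_basis_mem_span_tail [CharZero k] [Module.Finite k L] [LieAlgebra.IsSolvable L]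
    (hD : Submodule.span k (Set.range fun j => b (Sum.inr j)) =
    ⁅(⊤ : LieIdeal k L), (⊤ : LieIdeal k L)⁆.toSubmodule)
    (hlie : ∀ j : Fin m, ∀ x ∈ Submodule.span k ((fun j => b (Sum.inr j)) '' Set.Ici j),
    ∀ y ∈ Submodule.span k ((fun j => b (Sum.inr j)) '' Set.Ici j),
      ⁅x, y⁆ ∈ Submodule.span k ((fun j => b (Sum.inr j)) '' Set.Ici j))
    (j : Fin (n + m)) {y : L}
    (hy : y ∈ Submodule.span k (b.reindex finSumFinEquiv '' {i | (j : ℕ) + 1 ≤ i})) :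
    ⁅b.reindex finSumFinEquiv j, y⁆ ∈
      Submodule.span k (b.reindex finSumFinEquiv '' {i | (j : ℕ) + 1 ≤ i}) := by
  set c := b.reindex finSumFinEquiv
  rcases lt_or_ge (j : ℕ) n with hj | hj
  · exact lie_top_le_span_tail b hD hj
      (LieSubmodule.lie_mem_lie (LieSubmodule.mem_top _) (LieSubmodule.mem_top _))
  have hset : {i : Fin (n + m) | (j : ℕ) ≤ i} = insert j {i : Fin (n + m) | (j : ℕ) + 1 ≤ i} := by
    ext i
    simp only [Set.mem_ofPred_eq, Set.mem_insert_iff, Fin.ext_iff]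
    omega
  have hyD : y ∈ ⁅(⊤ : LieIdeal k L), (⊤ : LieIdeal k L)⁆.toSubmodule := by
    rw [← hD]
    have h1 : y ∈ Submodule.span k (c '' {i | n + 0 ≤ (i : ℕ)}) :=
      Submodule.span_mono (Set.image_mono fun i hi => by
        simp only [Set.mem_ofPred_eq] at hi ⊢
        omega) hy
    rw [span_tail_add] at h1
    simpa [Set.image_univ] using h1
  have hmem : ⁅y, c j⁆ ∈ Submodule.span k (c '' {i | (j : ℕ) ≤ i}) := by
    refine lie_mem_span_tail b hD hlie j ?_ (Submodule.subset_span ⟨j, le_refl (j : ℕ), rfl⟩)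
    rw [hset, Set.image_insert_eq]
    exact Submodule.span_mono (Set.subset_insert _ _) hy
  rw [hset, Set.image_insert_eq, Submodule.mem_span_insert] at hmem
  obtain ⟨a, z, hz, hyz⟩ := hmem
  have hj' : c j ∉ Submodule.span k (c '' {i | (j : ℕ) + 1 ≤ i}) :=
    c.linearIndependent.notMem_span_image fun h => by simp at h
  have ha := LieAlgebra.eq_zero_of_lie_eq_smul_add
    (LieAlgebra.isNilpotent_ad_of_mem_lie_top hyD)
    (fun w hw => lie_mem_span_tail b hD hlie _ hy hw) hj' hz hyz
  rw [← lie_skew, hyz, ha, zero_smul, zero_add]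
  exact Submodule.neg_mem _ hz

end TailSpan

/-! ### The derivative of Ad as a bracket of vector fields. -/

namespace LogChart

variable {E : Type*} [NormedAddCommGroup E] [NormedSpace ℝ E] [FiniteDimensional ℝ E]
  {G : Type*} [Group G] (κ : LogChart E G)

/-- `ad` is the commutator of the left-invariant vector fields at the origin. -/
theorem ad_eq_fderiv_leftDeriv (x y : E) :
    κ.ad x y = fderiv ℝ κ.leftDeriv 0 x y - fderiv ℝ κ.leftDeriv 0 y x := by
  let M : E × E → E := fun p => κ.mul p.1 p.2
  have hM : ContDiff ℝ ∞ M := κ.contDiff_mul'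
  have hMd : ∀ p, HasFDerivAt M (fderiv ℝ M p) p := fun p =>
    (hM.differentiable (by simp) p).hasFDerivAt
  have hM2 : HasFDerivAt (fderiv ℝ M) (fderiv ℝ (fderiv ℝ M) 0) 0 :=
    ((hM.fderiv_right (m := ∞) le_rfl).differentiable (by simp) 0).hasFDerivAt
  let ρ : E → E →L[ℝ] E := fun z => fderiv ℝ M (0, z) ∘L ContinuousLinearMap.inl ℝ E E
  have hρ : ∀ z, HasFDerivAt (fun w => κ.mul w z) (ρ z) 0 := fun z =>
    HasFDerivAt.comp (f := fun w : E => (w, z)) 0 (hMd (0, z)) (hasFDerivAt_prodMk_left 0 z)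
  have hl : κ.leftDeriv = fun z => fderiv ℝ M (z, 0) ∘L ContinuousLinearMap.inr ℝ E E := by
    ext1 z
    exact (κ.hasFDerivAt_leftDeriv z).unique
      (HasFDerivAt.comp (f := fun w : E => (z, w)) 0 (hMd (z, 0)) (hasFDerivAt_prodMk_right z 0))
  -- Differentiate z · w = (Ad(z) w) · z in w; `ρ z` is the differential of right translation by z.
  have hlρ : κ.leftDeriv = fun z => ρ z ∘L κ.Ad (κ.e z) := by
    ext1 z
    refine (κ.hasFDerivAt_leftDeriv z).unique ?_
    have h1 : HasFDerivAt (fun w => κ.mul w z) (ρ z) (κ.Ad (κ.e z) 0) := by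
      rw [map_zero]; exact hρ z
    refine (h1.comp 0 (κ.Ad (κ.e z)).hasFDerivAt).congr_of_eventuallyEq
      (Filter.Eventually.of_forall fun w => ?_)
    apply κ.e.injective
    simp [e_Ad]
  have hρ0 : ρ 0 = ContinuousLinearMap.id ℝ E := by
    refine (hρ 0).unique ?_
    simp only [mul_zero]
    exact hasFDerivAt_id 0
  have hd1 : ∀ a c : E, fderiv ℝ κ.leftDeriv 0 a c = fderiv ℝ (fderiv ℝ M) 0 (a, 0) (0, c) := by
    intro a c
    have h1 : HasFDerivAt (fun z : E => fderiv ℝ M (z, 0))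
        (fderiv ℝ (fderiv ℝ M) 0 ∘L ContinuousLinearMap.inl ℝ E E) 0 :=
      HasFDerivAt.comp (f := fun z : E => (z, (0 : E))) 0 hM2 (hasFDerivAt_prodMk_left 0 0)
    have h2 := h1.clm_comp (hasFDerivAt_const (ContinuousLinearMap.inr ℝ E E) (0 : E))
    rw [hl, h2.fderiv]
    simp
  have hd2 : ∀ a c : E, fderiv ℝ ρ 0 a c = fderiv ℝ (fderiv ℝ M) 0 (0, a) (c, 0) ∧
      DifferentiableAt ℝ ρ 0 := by
    intro a c
    have h1 : HasFDerivAt (fun z : E => fderiv ℝ M (0, z))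
        (fderiv ℝ (fderiv ℝ M) 0 ∘L ContinuousLinearMap.inr ℝ E E) 0 :=
      HasFDerivAt.comp (f := fun z : E => ((0 : E), z)) 0 hM2 (hasFDerivAt_prodMk_right 0 0)
    have h2 := h1.clm_comp (hasFDerivAt_const (ContinuousLinearMap.inl ℝ E E) (0 : E))
    refine ⟨?_, h2.differentiableAt⟩
    rw [h2.fderiv]
    simp
  have hd3 := ((hd2 0 0).2.hasFDerivAt.clm_comp κ.hasFDerivAt_Ad_zero).fderiv
  rw [← hlρ] at hd3
  -- Symmetry of the second derivative of the group law exchanges the derivatives of `ρ` and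
  -- `leftDeriv` at 0, with arguments swapped.
  have hsymm := (hM.contDiffAt (x := (0 : E × E))).isSymmSndFDerivAt (by
    rw [minSmoothness_of_isRCLikeNormedField]
    exact ENat.LEInfty.out)
  have h1 : fderiv ℝ κ.leftDeriv 0 x y = κ.ad x y + fderiv ℝ ρ 0 x y := by
    rw [hd3]
    simp [hρ0, κ.e_zero, κ.Ad_one]
  rw [h1, (hd2 x y).1, hsymm.eq, hd1 y x]
  abel

end LogChart

/-! ### One-parameter subgroups from integral curves. -/

section Exp

variable {E : Type*} [NormedAddCommGroup E] [NormedSpace ℝ E]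
  {G : Type*} [TopologicalSpace G] [ChartedSpace E G] [Group G]

theorem mulInvariantVectorField_one_apply (X : LieAlg E G) :
    mulInvariantVectorField X (1 : G) = X := by
  have h : ∀ f : G → G, f = id → ∀ v : E, (mfderiv 𝓘(ℝ, E) 𝓘(ℝ, E) f 1 : E →L[ℝ] E) v = v := by
    rintro f rfl v
    rw [mfderiv_id]
    rfl
  exact h _ (funext one_mul) X

theorem mulInvariantVectorField_zero_apply (g : G) :
    mulInvariantVectorField (0 : LieAlg E G) g = 0 :=
  (mfderiv 𝓘(ℝ, E) 𝓘(ℝ, E) (fun x : G => g * x) 1).map_zero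

variable [LieGroup 𝓘(ℝ, E) ∞ G]

theorem hasMFDerivAt_const_mul (g h : G) :
    HasMFDerivAt 𝓘(ℝ, E) 𝓘(ℝ, E) (fun x : G => g * x) h
      (mfderiv 𝓘(ℝ, E) 𝓘(ℝ, E) (fun x : G => g * x) h) :=
  ((contMDiff_mul_left (I := 𝓘(ℝ, E)) (n := ∞) (a := g)).mdifferentiable (by simp) h).hasMFDerivAt

theorem mfderiv_const_mul_mulInvariantVectorField (X : LieAlg E G) (g h : G) :
    mfderiv 𝓘(ℝ, E) 𝓘(ℝ, E) (fun x : G => g * x) h (mulInvariantVectorField X h) =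
      mulInvariantVectorField X (g * h) := by
  have h1 := hasMFDerivAt_const_mul (E := E) g (h * 1)
  have h2 := (h1.comp 1 (hasMFDerivAt_const_mul h 1)).mfderiv
  have h3 : ∀ f : G → G, f = (fun x : G => g * x) ∘ (fun x : G => h * x) → ∀ k, k = h * 1 →
      ∀ v : E, (mfderiv 𝓘(ℝ, E) 𝓘(ℝ, E) f 1 : E →L[ℝ] E) v =
        (mfderiv 𝓘(ℝ, E) 𝓘(ℝ, E) (fun x : G => g * x) k : E →L[ℝ] E)
          ((mfderiv 𝓘(ℝ, E) 𝓘(ℝ, E) (fun x : G => h * x) 1 : E →L[ℝ] E) v) := by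
    rintro f rfl k rfl v
    exact congrArg (fun T : E →L[ℝ] E => T v) h2
  exact (h3 (fun x => g * h * x) (by ext x; simp [mul_assoc]) h (mul_one h).symm X).symm

theorem IsMIntegralCurve.const_mul_mulInvariant {X : LieAlg E G} {γ : ℝ → G}
    (hγ : IsMIntegralCurve (I := 𝓘(ℝ, E)) γ (mulInvariantVectorField X)) (g : G) :
    IsMIntegralCurve (I := 𝓘(ℝ, E)) (fun s => g * γ s) (mulInvariantVectorField X) := by
  intro t
  have h1 := (hasMFDerivAt_const_mul (E := E) g (γ t)).comp t (hγ t)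
  rw [← mfderiv_const_mul_mulInvariantVectorField X g (γ t)]
  have h2 : ∀ (A : E →L[ℝ] E) (w : E), A ∘L (1 : ℝ →L[ℝ] ℝ).smulRight w =
      (1 : ℝ →L[ℝ] ℝ).smulRight (A w) := fun A w => by
    ext
    simp
  exact h1.congr_mfderiv (h2 _ _)

variable [T2Space G]

theorem IsMIntegralCurve.eq_of_mulInvariant {X : LieAlg E G} {γ γ' : ℝ → G}
    (hγ : IsMIntegralCurve (I := 𝓘(ℝ, E)) γ (mulInvariantVectorField X))
    (hγ' : IsMIntegralCurve (I := 𝓘(ℝ, E)) γ' (mulInvariantVectorField X)) {t₀ : ℝ}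
    (h : γ t₀ = γ' t₀) : γ = γ' := by
  have : IsManifold 𝓘(ℝ, E) 1 G := IsManifold.of_le (n := ∞) (by simp)
  refine isMIntegralCurve_Ioo_eq_of_contMDiff_boundaryless (t₀ := t₀) ?_ hγ hγ' h
  refine (contMDiff_mulInvariantVectorField X).of_le ?_
  rw [minSmoothness_of_isRCLikeNormedField]
  norm_num

theorem IsMIntegralCurve.lieExp_eq {X : LieAlg E G} {γ : ℝ → G}
    (hγ : IsMIntegralCurve (I := 𝓘(ℝ, E)) γ (mulInvariantVectorField X)) (h0 : γ 0 = 1) :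
    lieExp X = γ 1 := by
  have h : ∃ γ : ℝ → G,
      γ 0 = 1 ∧ IsMIntegralCurve (I := 𝓘(ℝ, E)) γ (mulInvariantVectorField X) := ⟨γ, h0, hγ⟩
  rw [lieExp, dif_pos h, h.choose_spec.2.eq_of_mulInvariant hγ (h.choose_spec.1.trans h0.symm)]

theorem lieExp_zero : lieExp (0 : LieAlg E G) = 1 := by
  have h : IsMIntegralCurve (I := 𝓘(ℝ, E)) (fun _ : ℝ => (1 : G))
      (mulInvariantVectorField (0 : LieAlg E G)) :=
    isMIntegralCurve_const (mulInvariantVectorField_zero_apply _)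
  exact h.lieExp_eq rfl

/-- If X had no curve, `lieExp X` would be the default value 1 = `lieExp 0`; injectivity forces X =
0, which has the constant curve. -/
theorem exists_isMIntegralCurve_of_injective
    (hinj : Function.Injective (lieExp : LieAlg E G → G)) (X : LieAlg E G) :
    ∃ γ : ℝ → G, γ 0 = 1 ∧ IsMIntegralCurve (I := 𝓘(ℝ, E)) γ (mulInvariantVectorField X) := by
  by_contra h
  have h1 : lieExp X = 1 := by rw [lieExp, dif_neg h]
  have h2 : X = 0 := hinj (h1.trans lieExp_zero.symm)
  subst h2
  exact h ⟨fun _ => 1, rfl, isMIntegralCurve_const (mulInvariantVectorField_zero_apply _)⟩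

theorem isMIntegralCurve_lieExp_smul (hinj : Function.Injective (lieExp : LieAlg E G → G))
    (X : LieAlg E G) :
    IsMIntegralCurve (I := 𝓘(ℝ, E)) (fun s : ℝ => lieExp (s • X)) (mulInvariantVectorField X) := by
  obtain ⟨γ, h0, hγ⟩ := exists_isMIntegralCurve_of_injective hinj X
  have : (fun s : ℝ => lieExp (s • X)) = γ := by
    ext1 s
    have h1 := hγ.comp_mul s
    rw [← mulInvariantVectorField_smul] at h1
    rw [h1.lieExp_eq (by simp [h0])]
    simp
  rwa [this]

/-- As functions of t both sides are integral curves of the same left-invariant field, equal at t =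
0. -/
theorem lieExp_smul_mul_smul (hinj : Function.Injective (lieExp : LieAlg E G → G))
    (X : LieAlg E G) (s t : ℝ) : (lieExp (s • X) * lieExp (t • X) : G) = lieExp ((s + t) • X) := by
  have h1 := (isMIntegralCurve_lieExp_smul hinj X).const_mul_mulInvariant (lieExp (s • X))
  have h2 := (isMIntegralCurve_lieExp_smul hinj X).comp_add s
  have h3 := h1.eq_of_mulInvariant h2 (t₀ := 0) (by simp [lieExp_zero])
  simpa [add_comm] using congrFun h3 t

end Exp

/-! ### The exponential chart of a Lie group and its bracket. -/

section LieGroupChart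

variable {E : Type*} [NormedAddCommGroup E] [NormedSpace ℝ E]
  {G : Type*} [TopologicalSpace G] [ChartedSpace E G]
  (F : E ≃ₘ⟮𝓘(ℝ, E), 𝓘(ℝ, E)⟯ G)

theorem hasMFDerivAt_diffeo (x : E) :
    HasMFDerivAt 𝓘(ℝ, E) 𝓘(ℝ, E) F x (mfderiv 𝓘(ℝ, E) 𝓘(ℝ, E) F x) :=
  (F.contMDiff.mdifferentiable (by simp) x).hasMFDerivAt

variable [Group G]

theorem mulInvariantVectorField_apply_of_eq_one {g : G} (hg : g = 1) (X : LieAlg E G) :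
    (mulInvariantVectorField X g : E) = X := by
  subst hg
  exact mulInvariantVectorField_one_apply X

theorem lieExp_injective_of_diffeo (hF : ∀ X : LieAlg E G, lieExp X = F X) :
    Function.Injective (lieExp : LieAlg E G → G) := by
  intro X Y h
  rw [hF, hF] at h
  exact F.injective h

variable [T2Space G] [LieGroup 𝓘(ℝ, E) ∞ G]

/-- The logarithmic chart of a Lie group whose exponential map is a diffeomorphism. -/
def LogChart.ofDiffeo (hF : ∀ X : LieAlg E G, lieExp X = F X) : LogChart E G where
  e := F.toEquiv
  contDiff_mul := by
    have h1 : ContMDiff 𝓘(ℝ, E × E) 𝓘(ℝ, E) ∞ fun p : E × E => F p.1 * F p.2 :=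
      (F.contMDiff.comp contDiff_fst.contMDiff).mul (F.contMDiff.comp contDiff_snd.contMDiff)
    exact (F.symm.contMDiff.comp h1).contDiff
  smul_mul_smul X s t := by
    have h := lieExp_smul_mul_smul (lieExp_injective_of_diffeo F hF) X s t
    rw [hF, hF, hF] at h
    exact h

theorem diffeo_zero (hF : ∀ X : LieAlg E G, lieExp X = F X) : F 0 = 1 :=
  (LogChart.ofDiffeo F hF).e_zero

theorem lieExp_zero_smul (X : LieAlg E G) : (lieExp ((0 : ℝ) • X) : G) = 1 := by
  rw [zero_smul, lieExp_zero]

theorem mfderiv_diffeo_zero (hF : ∀ X : LieAlg E G, lieExp X = F X) :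
    (mfderiv 𝓘(ℝ, E) 𝓘(ℝ, E) F 0 : E →L[ℝ] E) = ContinuousLinearMap.id ℝ E := by
  refine ContinuousLinearMap.ext fun (X : E) => ?_
  have h1 := isMIntegralCurve_lieExp_smul (G := G) (lieExp_injective_of_diffeo F hF) X 0
  have h2 : HasFDerivAt (fun s : ℝ => s • X) ((1 : ℝ →L[ℝ] ℝ).smulRight X) 0 :=
    ((1 : ℝ →L[ℝ] ℝ).smulRight X).hasFDerivAt
  have h3 := (hasMFDerivAt_diffeo F ((0 : ℝ) • X)).comp (0 : ℝ) h2.hasMFDerivAt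
  have h4 : ∀ f : ℝ → G, f = F ∘ (fun s : ℝ => s • X) → ∀ k, k = (0 : ℝ) • X →
      ∀ T : ℝ →L[ℝ] E, HasMFDerivAt 𝓘(ℝ, ℝ) 𝓘(ℝ, E) f 0 T →
        T 1 = (mfderiv 𝓘(ℝ, E) 𝓘(ℝ, E) F k : E →L[ℝ] E) X := by
    rintro _ rfl _ rfl T hT
    have h5 := congrArg (fun T : ℝ →L[ℝ] E => T 1) (hasMFDerivAt_unique hT h3)
    have h6 : ∀ A : E →L[ℝ] E, (A ∘L (1 : ℝ →L[ℝ] ℝ).smulRight X) 1 = A X := fun A => by simp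
    exact h5.trans (h6 _)
  have h7 := h4 _ (funext fun s => hF (s • X)) 0 (zero_smul _ _).symm _ h1
  rw [← h7]
  have h8 : ∀ v : E, ((1 : ℝ →L[ℝ] ℝ).smulRight v) 1 = v := fun v => by simp
  refine (h8 _).trans ?_
  exact mulInvariantVectorField_apply_of_eq_one
    (lieExp_zero_smul (E := E) X) X

/-- In the exponential chart, left-invariant vector fields are given by `LogChart.leftDeriv`. -/
theorem mfderiv_diffeo_leftDeriv (hF : ∀ X : LieAlg E G, lieExp X = F X) (X x : E) :
    (mfderiv 𝓘(ℝ, E) 𝓘(ℝ, E) F x : E →L[ℝ] E) ((LogChart.ofDiffeo F hF).leftDeriv x X) =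
      (mulInvariantVectorField (I := 𝓘(ℝ, E)) (X : LieAlg E G) (F x) : E) := by
  set κ := LogChart.ofDiffeo F hF
  have h1 := (hasMFDerivAt_diffeo F (κ.mul x 0)).comp 0 (κ.hasFDerivAt_leftDeriv x).hasMFDerivAt
  have h2 := (hasMFDerivAt_const_mul (E := E) (F x) (F 0)).comp 0 (hasMFDerivAt_diffeo F 0)
  have h3 : (F : E → G) ∘ κ.mul x = (fun g => F x * g) ∘ F := funext fun y => κ.e_mul x y
  rw [h3] at h1
  have h4 : ∀ k, k = κ.mul x 0 → ∀ g, g = F 0 →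
      (mfderiv 𝓘(ℝ, E) 𝓘(ℝ, E) F k : E →L[ℝ] E) (κ.leftDeriv x X) =
      (mfderiv 𝓘(ℝ, E) 𝓘(ℝ, E) (fun h : G => F x * h) g : E →L[ℝ] E)
        ((mfderiv 𝓘(ℝ, E) 𝓘(ℝ, E) F 0 : E →L[ℝ] E) X) := by
    rintro _ rfl _ rfl
    exact congrArg (fun T : E →L[ℝ] E => T X) (hasMFDerivAt_unique h1 h2)
  rw [h4 x (κ.mul_zero x).symm 1 (diffeo_zero F hF).symm, mfderiv_diffeo_zero F hF]
  rfl

theorem mpullback_mulInvariantVectorField_diffeo (hF : ∀ X : LieAlg E G, lieExp X = F X)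
    (X x : E) :
    (VectorField.mpullback 𝓘(ℝ, E) 𝓘(ℝ, E) F
      (mulInvariantVectorField (I := 𝓘(ℝ, E)) (X : LieAlg E G)) x : E) =
      (LogChart.ofDiffeo F hF).leftDeriv x X := by
  have h : ∀ T : E ≃L[ℝ] E, ∀ v w : E, T v = w → (T : E →L[ℝ] E).inverse w = v := by
    rintro T v _ rfl
    simp
  exact h (F.mfderivToContinuousLinearEquiv (by simp) x) _ _ (mfderiv_diffeo_leftDeriv F hF X x)

/-- The bracket of the Lie algebra is the derivative of the adjoint representation. -/
theorem LogChart.ofDiffeo_ad [CompleteSpace E] [FiniteDimensional ℝ E] (hF : ∀ X : LieAlg E G, lieExp X = F X)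
    (X Y : LieAlg E G) : (LogChart.ofDiffeo F hF).ad X Y = (⁅X, Y⁆ : LieAlg E G) := by
  set κ := LogChart.ofDiffeo F hF
  -- Pullback along the chart respects brackets, so the bracket of invariant fields can be computed
  -- in `E`, where `leftDeriv` gives the fields.
  have h1 := VectorField.mpullback_mlieBracket (I := 𝓘(ℝ, E)) (I' := 𝓘(ℝ, E)) (n := ∞) (f := F)
    (x₀ := (0 : E)) (mdifferentiableAt_mulInvariantVectorField X)
    (mdifferentiableAt_mulInvariantVectorField Y) F.contMDiff.contMDiffAt (by
      rw [minSmoothness_of_isRCLikeNormedField]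
      exact ENat.LEInfty.out)
  have hpull : ∀ Z : LieAlg E G, VectorField.mpullback 𝓘(ℝ, E) 𝓘(ℝ, E) F
      (mulInvariantVectorField Z) = fun x : E => κ.leftDeriv x (Z : E) := fun Z =>
    funext fun x => mpullback_mulInvariantVectorField_diffeo F hF Z x
  rw [hpull, hpull] at h1
  have hbr : ∀ V W : (x : E) → TangentSpace 𝓘(ℝ, E) x,
      VectorField.mlieBracket 𝓘(ℝ, E) V W 0 =
      VectorField.lieBracket ℝ V W 0 := fun V W => by
    rw [← VectorField.mlieBracketWithin_univ, VectorField.mlieBracketWithin_eq_lieBracketWithin]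
    exact congrFun (VectorField.lieBracketWithin_univ (𝕜 := ℝ) (E := E) (V := V) (W := W)) 0
  have hder : ∀ v Z : E, fderiv ℝ (fun x => κ.leftDeriv x Z) 0 v = fderiv ℝ κ.leftDeriv 0 v Z := by
    intro v Z
    have h2 := ((κ.contDiff_leftDeriv.differentiable (by simp) 0).hasFDerivAt).clm_apply
      (hasFDerivAt_const Z (0 : E))
    rw [h2.fderiv]
    simp
  have hinv : ∀ T : E →L[ℝ] E, T = ContinuousLinearMap.id ℝ E → ∀ w, T.inverse w = w := by
    rintro _ rfl w
    simp
  have hone : ∀ g : G, g = 1 → (VectorField.mlieBracket 𝓘(ℝ, E) (mulInvariantVectorField X)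
      (mulInvariantVectorField Y) g : E) = (⁅X, Y⁆ : LieAlg E G) := by
    rintro _ rfl
    rfl
  have h3 : ((⁅X, Y⁆ : LieAlg E G) : E) = VectorField.lieBracket ℝ
      (fun x : E => κ.leftDeriv x (X : E)) (fun x : E => κ.leftDeriv x (Y : E)) 0 :=
    ((hone _ (diffeo_zero F hF)).symm.trans
      (hinv _ (mfderiv_diffeo_zero F hF) _).symm).trans (h1.trans (hbr _ _))
  have h4 := κ.ad_eq_fderiv_leftDeriv X Y
  have h5 : ∀ a c : E, VectorField.lieBracket ℝ (fun x : E => κ.leftDeriv x a)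
      (fun x : E => κ.leftDeriv x c) 0 =
        fderiv ℝ κ.leftDeriv 0 a c - fderiv ℝ κ.leftDeriv 0 c a := fun a c => by
    simp [VectorField.lieBracket_eq, hder, κ.leftDeriv_zero]
  exact h4.trans ((h5 X Y).symm.trans h3.symm)

end LieGroupChart

/-! ### Conclusion for an arbitrary Haar measure on the Lie algebra. -/

open MeasureTheory in
theorem LogChart.isHaarMeasure_map_repr {E : Type*} [NormedAddCommGroup E] [NormedSpace ℝ E]
    [FiniteDimensional ℝ E] [MeasurableSpace E] [BorelSpace E] {G : Type*} [Group G]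
    [TopologicalSpace G] [IsTopologicalGroup G] [T2Space G] [SecondCountableTopology G]
    [MeasurableSpace G] [BorelSpace G] (κ : LogChart E G)
    (hκ : Continuous κ.e) (hκ' : Continuous κ.e.symm) {N : ℕ} (c : Module.Basis (Fin N) ℝ E)
    (hsub : ∀ j : ℕ, ∀ x ∈ Submodule.span ℝ (c '' {i | j ≤ i}),
      ∀ y ∈ Submodule.span ℝ (c '' {i | j ≤ i}), κ.ad x y ∈ Submodule.span ℝ (c '' {i | j ≤ i}))
    (hideal : ∀ j : Fin N, ∀ y ∈ Submodule.span ℝ (c '' {i | (j : ℕ) + 1 ≤ i}),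
      κ.ad (c j) y ∈ Submodule.span ℝ (c '' {i | (j : ℕ) + 1 ≤ i}))
    (μ : Measure E) [μ.IsAddHaarMeasure] :
    (μ.map fun X => (List.ofFn fun i => κ.e (c.repr X i • c i)).prod).IsHaarMeasure := by
  have h := κ.isHaarMeasure_map_ofFn_prod hκ hκ' c hsub hideal
  set Φ : (Fin N → ℝ) → G := fun t => (List.ofFn fun i => κ.e (t i • c i)).prod
  have hΦ : Measurable Φ := (κ.continuous_ofFn_prod hκ c).measurable
  let L : E ≃L[ℝ] (Fin N → ℝ) := c.equivFun.toContinuousLinearEquiv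
  have hμ : (μ.map L).IsAddHaarMeasure := L.isAddHaarMeasure_map μ
  have h1 : μ.map (fun X => (List.ofFn fun i => κ.e (c.repr X i • c i)).prod) =
      (μ.map L).map Φ := by
    rw [Measure.map_map hΦ L.continuous.measurable]
    rfl
  -- By uniqueness of Haar measure, μ in coordinates is a positive multiple of Lebesgue measure.
  rw [h1, Measure.isAddLeftInvariant_eq_smul (μ.map L) volume, Measure.map_smul]
  exact h.nnreal_smul _ (Measure.addHaarScalarFactor_pos_of_isAddHaarMeasure _ _).ne'

end

theorem proposition4p4 {E : Type*} [NormedAddCommGroup E] [NormedSpace ℝ E]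
    [FiniteDimensional ℝ E] [CompleteSpace E]
    {G : Type*} [TopologicalSpace G] [T2Space G] [SecondCountableTopology G]
    [ChartedSpace E G] [Group G] [LieGroup 𝓘(ℝ, E) ∞ G]
    [MeasurableSpace G] [BorelSpace G]
    [MeasurableSpace (LieAlg E G)] [BorelSpace (LieAlg E G)]
    (hG : IsExponentialSolvable E G)
    {n m : ℕ} (b : Module.Basis (Fin n ⊕ Fin m) ℝ (LieAlg E G))
    (hA : IsCoexponentialBasis (derivedIdeal E G).toSubmodule (fun i => b (Sum.inl i)))
    (hN : IsMalcevBasis (derivedIdeal E G).toSubmodule (fun j => b (Sum.inr j)))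
    (μ : MeasureTheory.Measure (LieAlg E G)) [μ.IsAddHaarMeasure] :
    (μ.map (secondKindMap b)).IsHaarMeasure := by
  obtain ⟨F, hF⟩ := hG.exp_diffeo
  have : LieAlgebra.IsSolvable (LieAlg E G) := hG.solvable
  have : Module.Finite ℝ (LieAlg E G) := ‹FiniteDimensional ℝ E›
  have : IsTopologicalGroup G := topologicalGroup_of_lieGroup 𝓘(ℝ, E) ∞
  let _ : MeasurableSpace E := ‹MeasurableSpace (LieAlg E G)›
  have : BorelSpace E := ‹BorelSpace (LieAlg E G)›
  have : MeasureTheory.Measure.IsAddHaarMeasure (G := E) μ := ‹μ.IsAddHaarMeasure›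
  set κ := LogChart.ofDiffeo F hF
  have hmap : secondKindMap b = fun X : LieAlg E G => (List.ofFn fun i : Fin (n + m) =>
      κ.e ((b.reindex finSumFinEquiv).repr X i • b.reindex finSumFinEquiv i)).prod := by
    ext1 X
    have he : ∀ Y : LieAlg E G, κ.e Y = lieExp Y := fun Y => (hF Y).symm
    -- The product over `Fin (n + m)` splits after its first n factors into the A-part and the
    -- N-part.
    have hl : ∀ (h : n ≤ n + m) (i : Fin n), finSumFinEquiv.symm (Fin.castLE h i) =
        (Sum.inl i : Fin n ⊕ Fin m) := fun _ i => finSumFinEquiv_symm_apply_castAdd i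
    rw [List.ofFn_add, List.prod_append]
    simp only [he, secondKindMap, expProd]
    simp [hl]
  rw [hmap]
  refine LogChart.isHaarMeasure_map_repr (E := E) κ F.continuous F.symm.continuous
    (b.reindex finSumFinEquiv) (fun j x hx y hy => ?_) (fun j y hy => ?_) μ
  · exact Set.mem_of_eq_of_mem (LogChart.ofDiffeo_ad F hF x y)
      (lie_mem_span_tail b hN.span_eq hN.lie_mem j hx hy)
  · exact Set.mem_of_eq_of_mem (LogChart.ofDiffeo_ad F hF _ y)
      (lie_basis_mem_span_tail b hN.span_eq hN.lie_mem j hy)
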